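/- A generalized almost contact structure on a smooth manifold $M$ of dimension $2n+1$ is a triple $(\Phi,E_+,E_-)$ consisting of a smooth bundle endomorphism $\Phi$ of $TM\oplus T^*M$ and smooth sections $E_\pm=X_\pm+\eta_\pm$ of $TM\oplus T^*M$ such that, for the pairing $\langle X+\xi,Y+\beta\rangle=\tfrac12(\xi(Y)+\beta(X))$, $$\Phi+\Phi^*=0,\quad \langle E_+,E_-\rangle=\tfrac12,\quad \langle E_\pm,E_\pm\rangle=0,\quad \Phi^2u=-u+2\big(\langle E_-,u\rangle E_++\langle E_+,u\rangle E_-\big)\ \text{ for all } u .$$ Put $R:=X_++X_-$ and $\eta:=\eta_++\eta_-$; then $\eta(R)=1$. Let $\mathcal R$ be the foliation of $M$ into orbits (images of maximal integral curves) of $R$, let $M/\mathcal R$ be its leaf space with the quotient topology, and let $\Psi:M\to M/\mathcal R$ be the canonical projection. (Manifolds are Hausdorff, second countable and without boundary.) **Theorem.** Let $(M,\Phi,E_\pm)$ be a connected generalized almost contact manifold of dimension $2n+1$ that is regular with respect to $R$, i.e. the leaf space $M/\mathcal R$ is a smooth manifold of dimension $2n$ such that $\Psi$ is a (surjective) submersion.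 Suppose that $i_R\,d\eta=0$ and that $\Psi$ is a smooth fiber bundle with typical fiber $S^1$. Then: 1. $R$ is complete, and there is a number $\gamma>0$ such that every $R$-orbit is periodic with minimal period $\gamma$: for every $x\in M$, $\gamma$ is the least $T>0$ such that $e^{(t+T)R}(x)=e^{tR}(x)$ for all $t\in\mathbb R$. 2. The flow of $R$ induces an action of the Lie group $\mathbb R/\gamma\mathbb Z\cong S^1$ on $M$, $[t]\cdot x=e^{tR}(x)$, which makes $\Psi:M\to M/\mathcal R$ a smooth principal $\mathbb R/\gamma\mathbb Z$-bundle. The form $\eta$ is a connection $1$-form of this bundle (where the Lie algebra of $\mathbb R/\gamma\mathbb Z$ is identified with $\mathbb R$). There is a unique $2$-form $\omega$ on $M/\mathcal R$ with $d\eta=\Psi^*\omega$; it is smooth and closed, and it is the curvature of $\eta$, i.e. $\Psi^*\omega$ is the curvature form $(v,w)\mapsto d\eta(\mathrm{hor}\,v,\mathrm{hor}\,w)$, where $\mathrm{hor}\,v=v-\eta(v)R$ is the horizontal part of $v$. -/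

import Mathlib

open scoped Manifold ContDiff Topology
open Set

noncomputable section

/-! ### The circle `ℝ/pℤ` as a Lie group -/

/-- The smooth structure on `ℝ/pℤ`: the charts are all the local inverses of the covering
projection `ℝ → ℝ/pℤ`. -/
instance AddCircle.chartedSpaceReal (p : ℝ) : ChartedSpace ℝ (AddCircle p) where
  atlas := {e | ∀ t : ℝ, e.symm t = (t : AddCircle p)}
  chartAt q := (AddCircle.isLocalHomeomorph_coe p).localInverseAt q.out
  mem_chart_source q := by
    have h := (AddCircle.isLocalHomeomorph_coe p).apply_self_mem_localInverseAt_source (x := q.out)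
    rwa [show ((q.out : ℝ) : AddCircle p) = q from Quotient.out_eq q] at h
  chart_mem_atlas q := fun t =>
    congrFun ((AddCircle.isLocalHomeomorph_coe p).localInverseAt_symm q.out) t

theorem AddCircle.coe_chart {p : ℝ} {e : OpenPartialHomeomorph (AddCircle p) ℝ}
    (he : e ∈ atlas ℝ (AddCircle p)) {q : AddCircle p} (hq : q ∈ e.source) :
    ((e q : ℝ) : AddCircle p) = q := by
  have h : ∀ t : ℝ, e.symm t = (t : AddCircle p) := he
  rw [← h, e.left_inv hq]

/-- Two continuous lifts of the same map to `ℝ/pℤ` differ locally by a constant. -/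
theorem AddCircle.eventually_lift_eq {p : ℝ} {N : Type*} [TopologicalSpace N] {φ ψ : N → ℝ} {x : N}
    (hφ : ContinuousAt φ x) (hψ : ContinuousAt ψ x)
    (h : ∀ᶠ y in 𝓝 x, (φ y : AddCircle p) = (ψ y : AddCircle p)) :
    ∀ᶠ y in 𝓝 x, φ y = ψ y + (φ x - ψ x) := by
  have hinj := ((AddCircle.isLocalHomeomorph_coe p).isLocallyInjective) (φ x)
  obtain ⟨U, hU, hxU, hi⟩ := hinj
  have hc : ContinuousAt (fun y => ψ y + (φ x - ψ x)) x := hψ.add continuousAt_const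
  have h1 := hφ.preimage_mem_nhds (hU.mem_nhds hxU)
  have h2 := hc.preimage_mem_nhds (t := U) (hU.mem_nhds (by simpa using hxU))
  have hx := h.self_of_nhds
  filter_upwards [h1, h2, h] with y hy1 hy2 hy
  apply hi hy1 hy2
  rw [hy, AddCircle.coe_add, AddCircle.coe_sub, hx, sub_self, add_zero]

theorem AddCircle.contMDiffAt_of_lift {p : ℝ} {E N : Type*} [NormedAddCommGroup E]
    [NormedSpace ℝ E] {H : Type*} [TopologicalSpace H] {I : ModelWithCorners ℝ E H}
    [TopologicalSpace N] [ChartedSpace H N] {φ ψ : N → ℝ} {x : N}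
    (hφ : ContinuousAt φ x) (hψ : ContMDiffAt I 𝓘(ℝ, ℝ) ∞ ψ x)
    (h : ∀ᶠ y in 𝓝 x, (φ y : AddCircle p) = (ψ y : AddCircle p)) :
    ContMDiffAt I 𝓘(ℝ, ℝ) ∞ φ x :=
  (hψ.add contMDiffAt_const).congr_of_eventuallyEq
    (AddCircle.eventually_lift_eq hφ hψ.continuousAt h)

instance AddCircle.isManifoldReal (p : ℝ) : IsManifold 𝓘(ℝ, ℝ) ∞ (AddCircle p) := by
  apply isManifold_of_contDiffOn
  intro e e' he he' t ht
  have ht' : t ∈ (e.symm ≫ₕ e').source := by simpa using ht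
  have hs : ∀ᶠ y in 𝓝 t, y ∈ (e.symm ≫ₕ e').source :=
    (e.symm ≫ₕ e').open_source.mem_nhds ht'
  have hlift : ∀ᶠ y in 𝓝 t,
      (((e.symm ≫ₕ e') y : ℝ) : AddCircle p) = ((id y : ℝ) : AddCircle p) := by
    filter_upwards [hs] with y hy
    rw [OpenPartialHomeomorph.trans_source] at hy
    have := AddCircle.coe_chart he' (q := e.symm y) hy.2
    have h2 : ∀ t : ℝ, e.symm t = (t : AddCircle p) := he
    simpa [h2] using this
  have := AddCircle.contMDiffAt_of_lift (I := 𝓘(ℝ, ℝ))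
    ((e.symm ≫ₕ e').continuousAt ht') contMDiffAt_id hlift
  exact (contMDiffAt_iff_contDiffAt.mp this).contDiffWithinAt

/-- A continuous map to `ℝ/pℤ` that has a smooth lift near a point is smooth there. -/
theorem AddCircle.contMDiffAt_of_coe {p : ℝ} {E N : Type*} [NormedAddCommGroup E]
    [NormedSpace ℝ E] {H : Type*} [TopologicalSpace H] {I : ModelWithCorners ℝ E H}
    [TopologicalSpace N] [ChartedSpace H N] {f : N → AddCircle p} {ψ : N → ℝ} {x : N}
    (hf : ContinuousAt f x) (hψ : ContMDiffAt I 𝓘(ℝ, ℝ) ∞ ψ x)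
    (h : ∀ᶠ y in 𝓝 x, f y = (ψ y : AddCircle p)) :
    ContMDiffAt I 𝓘(ℝ, ℝ) ∞ f x := by
  rw [contMDiffAt_iff_target]
  refine ⟨hf, ?_⟩
  have hsrc := hf.preimage_mem_nhds (chart_source_mem_nhds ℝ (f x))
  refine AddCircle.contMDiffAt_of_lift (p := p) ?_ hψ ?_
  · exact (continuousAt_extChartAt (I := 𝓘(ℝ, ℝ)) (f x)).comp hf
  · filter_upwards [h, hsrc] with y hy hys
    rw [← hy]
    simpa using AddCircle.coe_chart (chart_mem_atlas ℝ (f x)) hys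

theorem AddCircle.eventually_coe_extChartAt {p : ℝ} (q : AddCircle p) :
    ∀ᶠ y in 𝓝 q, ((extChartAt 𝓘(ℝ, ℝ) q y : ℝ) : AddCircle p) = y := by
  filter_upwards [chart_source_mem_nhds ℝ q] with y hy
  simpa using AddCircle.coe_chart (chart_mem_atlas ℝ q) hy

instance AddCircle.lieAddGroupReal (p : ℝ) : LieAddGroup 𝓘(ℝ, ℝ) ∞ (AddCircle p) where
  contMDiff_add := by
    rintro ⟨a, b⟩
    have ha : ContMDiffAt (𝓘(ℝ, ℝ).prod 𝓘(ℝ, ℝ)) 𝓘(ℝ, ℝ) ∞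
        (fun z : AddCircle p × AddCircle p => extChartAt 𝓘(ℝ, ℝ) a z.1) (a, b) :=
      (contMDiffAt_extChartAt (x := a)).comp (a, b) contMDiffAt_fst
    have hb : ContMDiffAt (𝓘(ℝ, ℝ).prod 𝓘(ℝ, ℝ)) 𝓘(ℝ, ℝ) ∞
        (fun z : AddCircle p × AddCircle p => extChartAt 𝓘(ℝ, ℝ) b z.2) (a, b) :=
      (contMDiffAt_extChartAt (x := b)).comp (a, b) contMDiffAt_snd
    refine AddCircle.contMDiffAt_of_coe continuous_add.continuousAt (ha.add hb) ?_
    filter_upwards [continuousAt_fst.eventually (AddCircle.eventually_coe_extChartAt a),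
      continuousAt_snd.eventually (AddCircle.eventually_coe_extChartAt b)] with z h1 h2
    rw [Pi.add_apply, AddCircle.coe_add, h1, h2]
  contMDiff_neg := by
    intro a
    refine AddCircle.contMDiffAt_of_coe continuous_neg.continuousAt
      (contMDiffAt_extChartAt (x := a)).neg ?_
    filter_upwards [AddCircle.eventually_coe_extChartAt a] with z h1
    rw [AddCircle.coe_neg, h1]

/-! ### Differential forms on manifolds without boundary -/

section Forms

variable {E M : Type*} [NormedAddCommGroup E] [NormedSpace ℝ E]
  [TopologicalSpace M] [ChartedSpace E M]
  {E' N : Type*} [NormedAddCommGroup E'] [NormedSpace ℝ E']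
  [TopologicalSpace N] [ChartedSpace E' N]

variable (E M) in
/-- (Not necessarily smooth) differential `k`-forms on `M`. -/
abbrev DForm (k : ℕ) : Type _ := ∀ x : M, TangentSpace 𝓘(ℝ, E) x [⋀^Fin k]→L[ℝ] ℝ

/-- The pullback `f^* α` of a form along a (differentiable) map. -/
def DForm.pullback {k : ℕ} (f : N → M) (α : DForm E M k) : DForm E' N k := fun x =>
  (α (f x)).compContinuousLinearMap (mfderiv 𝓘(ℝ, E') 𝓘(ℝ, E) f x)

/-- The expression of `α` in the chart of `M` around `x₀`: the pullback of `α` along the inverse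
chart, a form on the open subset `(extChartAt 𝓘(ℝ, E) x₀).target` of `E`. -/
def DForm.inChart {k : ℕ} (α : DForm E M k) (x₀ : M) : E → E [⋀^Fin k]→L[ℝ] ℝ := fun y =>
  (α ((extChartAt 𝓘(ℝ, E) x₀).symm y)).compContinuousLinearMap
    (mfderiv 𝓘(ℝ, E) 𝓘(ℝ, E) (extChartAt 𝓘(ℝ, E) x₀).symm y : E →L[ℝ] _)

/-- A form is smooth if it is smooth in all charts. -/
def DForm.IsSmooth {k : ℕ} (α : DForm E M k) : Prop :=
  ∀ x₀ : M, ContDiffOn ℝ ∞ (α.inChart x₀) (extChartAt 𝓘(ℝ, E) x₀).target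

/-- The exterior derivative, computed at `x` in the chart around `x`, with the convention
`dη(X, Y) = X(η(Y)) - Y(η(X)) - η([X, Y])` for 1-forms. -/
def DForm.d {k : ℕ} (α : DForm E M k) : DForm E M (k + 1) := fun x =>
  (extDeriv (α.inChart x) (extChartAt 𝓘(ℝ, E) x x)).compContinuousLinearMap
    (mfderiv 𝓘(ℝ, E) 𝓘(ℝ, E) (extChartAt 𝓘(ℝ, E) x) x : _ →L[ℝ] E)

/-- A field of covectors, seen as a 1-form. -/
def DForm.ofCovectors (ξ : ∀ x : M, TangentSpace 𝓘(ℝ, E) x →L[ℝ] ℝ) : DForm E M 1 := fun x =>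
  ContinuousAlternatingMap.ofSubsingleton ℝ (TangentSpace 𝓘(ℝ, E) x) ℝ (0 : Fin 1) (ξ x)

end Forms

/-! ### Generalized almost contact structures -/

section GenContact

variable (E : Type*) {M : Type*} [NormedAddCommGroup E] [NormedSpace ℝ E]
  [TopologicalSpace M] [ChartedSpace E M]

/-- The fiber `T_x M ⊕ T_x^* M` of the generalized tangent bundle. -/
abbrev GenTangentSpace (x : M) : Type _ :=
  TangentSpace 𝓘(ℝ, E) x × (TangentSpace 𝓘(ℝ, E) x →L[ℝ] ℝ)

variable {E}

/-- The natural pairing `⟨X + ξ, Y + β⟩ = (ξ(Y) + β(X)) / 2`. -/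
def genPairing {x : M} (u v : GenTangentSpace E x) : ℝ := (u.2 v.1 + v.2 u.1) / 2

/-- Smooth sections `X + ξ` of `TM ⊕ T^*M`: `X` is a smooth vector field and `ξ` a smooth
1-form. -/
def IsSmoothGenSection [IsManifold 𝓘(ℝ, E) ∞ M] (u : ∀ x : M, GenTangentSpace E x) : Prop :=
  ContMDiff 𝓘(ℝ, E) 𝓘(ℝ, E).tangent ∞ (fun x => (⟨x, (u x).1⟩ : TangentBundle 𝓘(ℝ, E) M)) ∧
  (DForm.ofCovectors fun x => (u x).2).IsSmooth

variable (E M) in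
/-- A generalized almost contact structure `(Φ, E₊, E₋)` on `M`. -/
structure GenAlmostContactStructure [IsManifold 𝓘(ℝ, E) ∞ M] where
  /-- the endomorphism of `TM ⊕ T^*M` -/
  Φ : ∀ x : M, GenTangentSpace E x →ₗ[ℝ] GenTangentSpace E x
  /-- the section `E₊ = X₊ + η₊` -/
  Ep : ∀ x : M, GenTangentSpace E x
  /-- the section `E₋ = X₋ + η₋` -/
  Em : ∀ x : M, GenTangentSpace E x
  /-- `Φ` is smooth: it maps smooth sections to smooth sections -/
  smooth_Φ : ∀ u : ∀ x : M, GenTangentSpace E x,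
    IsSmoothGenSection u → IsSmoothGenSection fun x => Φ x (u x)
  smooth_Ep : IsSmoothGenSection Ep
  smooth_Em : IsSmoothGenSection Em
  skew : ∀ (x : M) (u v : GenTangentSpace E x),
    genPairing (Φ x u) v + genPairing u (Φ x v) = 0
  pairing_Ep_Em : ∀ x, genPairing (Ep x) (Em x) = 1 / 2
  pairing_Ep_Ep : ∀ x, genPairing (Ep x) (Ep x) = 0
  pairing_Em_Em : ∀ x, genPairing (Em x) (Em x) = 0
  sq : ∀ (x : M) (u : GenTangentSpace E x),
    Φ x (Φ x u) = -u + (2 : ℝ) • (genPairing (Em x) u • Ep x + genPairing (Ep x) u • Em x)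

variable [IsManifold 𝓘(ℝ, E) ∞ M]

/-- The associated vector field `R = X₊ + X₋`. -/
def GenAlmostContactStructure.R (S : GenAlmostContactStructure E M) (x : M) :
    TangentSpace 𝓘(ℝ, E) x :=
  (S.Ep x).1 + (S.Em x).1

/-- The associated 1-form `η = η₊ + η₋`. -/
def GenAlmostContactStructure.η (S : GenAlmostContactStructure E M) : DForm E M 1 :=
  DForm.ofCovectors fun x => (S.Ep x).2 + (S.Em x).2

end GenContact

/-! ### Flows, orbits and leaf spaces -/

section Flows

variable {E M : Type*} [NormedAddCommGroup E] [NormedSpace ℝ E]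
  [TopologicalSpace M] [ChartedSpace E M]

/-- `x` and `y` lie on a common integral curve of `X`, defined on an open interval. -/
def OnSameOrbit (X : ∀ x : M, TangentSpace 𝓘(ℝ, E) x) (x y : M) : Prop :=
  ∃ (c : ℝ → M) (a b : ℝ), IsMIntegralCurveOn c X (Ioo a b) ∧
    ∃ s ∈ Ioo a b, ∃ t ∈ Ioo a b, c s = x ∧ c t = y

/-- The leaf space of the foliation of `M` into the orbits of `X`, with the quotient topology. -/
abbrev LeafSpace (X : ∀ x : M, TangentSpace 𝓘(ℝ, E) x) : Type _ := Quot (OnSameOrbit X)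

/-- The canonical projection `M → M/𝓡`. -/
def leafProj (X : ∀ x : M, TangentSpace 𝓘(ℝ, E) x) : M → LeafSpace X := Quot.mk _

/-- `θ` is the global flow `(t, x) ↦ e^{tX}(x)` of the vector field `X` (in particular `X` is
complete). -/
def IsGlobalFlow (X : ∀ x : M, TangentSpace 𝓘(ℝ, E) x) (θ : ℝ → M → M) : Prop :=
  ∀ x, θ 0 x = x ∧ IsMIntegralCurve (fun t => θ t x) X

end Flows

/-! ### Fiber bundles, principal bundles and connections -/

section Bundles

variable {E P : Type*} [NormedAddCommGroup E] [NormedSpace ℝ E]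
  [TopologicalSpace P] [ChartedSpace E P]
  {EB B : Type*} [NormedAddCommGroup EB] [NormedSpace ℝ EB]
  [TopologicalSpace B] [ChartedSpace EB B]
  {EF F : Type*} [NormedAddCommGroup EF] [NormedSpace ℝ EF]
  [TopologicalSpace F] [ChartedSpace EF F]

variable (E EB EF) in
/-- A local trivialization of `π : P → B` with fiber `F` that is a diffeomorphism from
`π⁻¹(V)` onto `V × F`. -/
def IsSmoothTrivialization {π : P → B} (e : Bundle.Trivialization F π) : Prop :=
  ContMDiffOn 𝓘(ℝ, E) (𝓘(ℝ, EB).prod 𝓘(ℝ, EF)) ∞ e e.source ∧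
  ContMDiffOn (𝓘(ℝ, EB).prod 𝓘(ℝ, EF)) 𝓘(ℝ, E) ∞ e.toOpenPartialHomeomorph.symm e.target

variable (E EB EF F) in
/-- `π : P → B` is a smooth fiber bundle with typical fiber `F`. -/
def IsSmoothFiberBundle (π : P → B) : Prop :=
  ∀ b : B, ∃ e : Bundle.Trivialization F π, b ∈ e.baseSet ∧ IsSmoothTrivialization E EB EF e

variable (E EB) in
/-- `π : P → B`, with the given action on `P`, is a smooth principal bundle with structure group
the (additively written) Lie group `G`. -/
structure IsSmoothPrincipalBundle (EG : Type*) [NormedAddCommGroup EG] [NormedSpace ℝ EG]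
    (G : Type*) [AddGroup G] [TopologicalSpace G] [ChartedSpace EG G]
    [LieAddGroup 𝓘(ℝ, EG) ∞ G] [AddAction G P] (π : P → B) : Prop where
  smooth_proj : ContMDiff 𝓘(ℝ, E) 𝓘(ℝ, EB) ∞ π
  smooth_action : ContMDiffVAdd 𝓘(ℝ, EG) 𝓘(ℝ, E) ∞ G P
  free : ∀ (g : G) (x : P), g +ᵥ x = x → g = 0
  fiber_iff : ∀ x y : P, π x = π y ↔ ∃ g : G, g +ᵥ x = y
  /-- there are equivariant smooth local trivializations around every point -/
  locally_trivial : ∀ b : B, ∃ e : Bundle.Trivialization G π, b ∈ e.baseSet ∧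
    IsSmoothTrivialization E EB EG e ∧ ∀ x ∈ e.source, ∀ g : G, (e (g +ᵥ x)).2 = g + (e x).2

/-- The fundamental vector field of an action of `ℝ/pℤ`, that is the vector field
`x ↦ d/dt|_{t = 0} ([t] +ᵥ x)` generated by the element `1` of the Lie algebra `ℝ` of `ℝ/pℤ`. -/
def fundamentalField (p : ℝ) [AddAction (AddCircle p) P] (x : P) : TangentSpace 𝓘(ℝ, E) x :=
  (mfderiv 𝓘(ℝ, ℝ) 𝓘(ℝ, E) (fun t : ℝ => (t : AddCircle p) +ᵥ x) 0 (1 : ℝ) : E)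

/-- `A` is (the 1-form of) a connection on the principal `ℝ/pℤ`-bundle `P`; the Lie algebra of
`ℝ/pℤ` is `ℝ`, and the adjoint action is trivial. -/
structure IsConnectionForm (p : ℝ) [AddAction (AddCircle p) P] (A : DForm E P 1) : Prop where
  smooth : A.IsSmooth
  apply_fundamentalField : ∀ x : P, A x ![fundamentalField p x] = 1
  invariant : ∀ g : AddCircle p, A.pullback (fun x : P => g +ᵥ x) = A

/-- The projection `v ↦ v - A(v) ξ` of `T_x P` onto the horizontal space `ker A_x`, where `ξ` is
the fundamental vector field. -/
def horizontalProj (p : ℝ) [AddAction (AddCircle p) P] (A : DForm E P 1) (x : P) :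
    TangentSpace 𝓘(ℝ, E) x →L[ℝ] TangentSpace 𝓘(ℝ, E) x :=
  ContinuousLinearMap.id ℝ _ -
    ((ContinuousAlternatingMap.ofSubsingleton ℝ (TangentSpace 𝓘(ℝ, E) x) ℝ (0 : Fin 1)).symm
      (A x)).smulRight (fundamentalField p x)

/-- The curvature 2-form `(v, w) ↦ dA(hor v, hor w)` on `P` of the connection form `A`. -/
def connectionCurvature (p : ℝ) [AddAction (AddCircle p) P] (A : DForm E P 1) : DForm E P 2 :=
  fun x => (A.d x).compContinuousLinearMap (horizontalProj p A x)

end Bundles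

end

open Filter

noncomputable section

/-! Besides smoothness, the contact data enter through three facts: `η(R) = 1`, `i_R dη = 0`, and
the tangency of `R` to the fibers of the projection.

Over a small convex set of base coordinates `y`, the circle bundle has an angular coordinate `s` of
period `2π`. There `∂ₛ` is a nonvanishing multiple of `R`, so the pullback `β` of `η` satisfies
`i_{∂ₛ} dβ = 0`, hence `L_{∂ₛ} dβ = 0`, and `dβ` comes from the base. Let `A` be the restriction of
`β` to `s = 0`, extended independently of `s`. Then `β - A` is closed, and the Poincaré lemma gives
`T` with `dT = β - A`. Since `∂ₛT = β(∂ₛ) ≠ 0`, `T` is a new fiber coordinate `t`, in which `η = dt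
+ A` and `R = ∂ₜ` (`IsStraightenable.exists_straightening`, `IsPolarChart.exists_isFlowBox`).

The conclusions are read off from this normal form. The flow is the translation of `t`, hence
complete. As `β` is periodic, `T (y, s + 2π) - T (y, s)` is a constant `c`, so nearby orbits share
the period `|c|`, and connectedness makes the period global (`exists_common_period`). Translations
preserve `dt + A`, so `η` is a connection form. Finally `dη = dA` descends to the base, where local
sections show that it is locally exact, hence smooth and closed (`IsReebPair.exists_base_form`). -/

theorem minSmoothness_two_le_infty : minSmoothness ℝ 2 ≤ (∞ : WithTop ℕ∞) := by
  rw [minSmoothness_of_isRCLikeNormedField]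
  exact WithTop.coe_le_coe.2 (le_top : (2 : ℕ∞) ≤ ⊤)

/-! ### Pullbacks of forms to normed spaces, and naturality of the exterior derivative. -/

section PullbackToVectorSpace

variable {V E M : Type*} [NormedAddCommGroup V] [NormedSpace ℝ V]
  [NormedAddCommGroup E] [NormedSpace ℝ E] [TopologicalSpace M] [ChartedSpace E M]

/-- The pullback of a form along a map from a normed space, as a form on the normed space. -/
def DForm.pullbackVec {k : ℕ} (f : V → M) (α : DForm E M k) : V → V [⋀^Fin k]→L[ℝ] ℝ := fun z =>
  (α (f z)).compContinuousLinearMap (mfderiv 𝓘(ℝ, V) 𝓘(ℝ, E) f z : V →L[ℝ] _)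

theorem DForm.pullbackVec_apply {k : ℕ} (f : V → M) (α : DForm E M k) (z : V) (v : Fin k → V) :
    α.pullbackVec f z v = α (f z) fun i => mfderiv 𝓘(ℝ, V) 𝓘(ℝ, E) f z (v i) := rfl

/-- The pullback of a 1-form along a map from a normed space, as a covector field. -/
def DForm.covPullback (f : V → M) (α : DForm E M 1) : V → V →L[ℝ] ℝ := fun z =>
  (ContinuousAlternatingMap.ofSubsingleton ℝ V ℝ (0 : Fin 1)).symm (α.pullbackVec f z)

theorem DForm.covPullback_apply (f : V → M) (α : DForm E M 1) (z v : V) :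
    α.covPullback f z v = α (f z) ![mfderiv 𝓘(ℝ, V) 𝓘(ℝ, E) f z v] := by
  have : (![mfderiv 𝓘(ℝ, V) 𝓘(ℝ, E) f z v] : Fin 1 → TangentSpace 𝓘(ℝ, E) (f z)) =
      fun _ => mfderiv 𝓘(ℝ, V) 𝓘(ℝ, E) f z v := by
    ext i; fin_cases i; rfl
  rw [this]; rfl

/-- Writing `f` near `z` as the inverse chart after its coordinate expression, the chain rule
reduces the pullback to one between normed spaces. Smoothness and exterior derivatives of pullbacks
are then computed there. -/
theorem DForm.pullbackVec_eventuallyEq_inChart [IsManifold 𝓘(ℝ, E) ∞ M] {k : ℕ} {f : V → M}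
    (α : DForm E M k) {z : V} (hf : ContMDiffAt 𝓘(ℝ, V) 𝓘(ℝ, E) ∞ f z) :
    ∀ᶠ z' in 𝓝 z, α.pullbackVec f z' =
      (α.inChart (f z) (extChartAt 𝓘(ℝ, E) (f z) (f z'))).compContinuousLinearMap
        (fderiv ℝ (fun w => extChartAt 𝓘(ℝ, E) (f z) (f w)) z') := by
  have hc := hf.continuousAt.eventually (extChartAt_source_mem_nhds (I := 𝓘(ℝ, E)) (f z))
  -- Smoothness of order `1` at a point spreads to a neighbourhood; smoothness of order `∞` at a
  -- point need not.
  have hd : ∀ᶠ z' in 𝓝 z, ContMDiffAt 𝓘(ℝ, V) 𝓘(ℝ, E) 1 f z' :=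
    (contMDiffAt_iff_contMDiffAt_nhds (by simp)).1 (ContMDiffAt.of_le hf (by simp))
  filter_upwards [hc.eventually_nhds, hd] with z' hz' hdz'
  have hs := hz'.self_of_nhds
  set φ := extChartAt 𝓘(ℝ, E) (f z)
  have hφ : MDifferentiableAt 𝓘(ℝ, E) 𝓘(ℝ, E) φ (f z') :=
    (contMDiffAt_extChartAt' (n := 1) (by rw [← extChartAt_source 𝓘(ℝ, E)]; exact hs)).mdifferentiableAt (by simp)
  have hψ : MDifferentiableAt 𝓘(ℝ, E) 𝓘(ℝ, E) φ.symm (φ (f z')) :=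
    ((contMDiffOn_extChartAt_symm (n := 1) (f z)).contMDiffAt
      ((isOpen_extChartAt_target (f z)).mem_nhds (φ.map_source hs))).mdifferentiableAt (by simp)
  have hfd : MDifferentiableAt 𝓘(ℝ, V) 𝓘(ℝ, E) f z' := hdz'.mdifferentiableAt (by simp)
  have key : (mfderiv 𝓘(ℝ, V) 𝓘(ℝ, E) f z' : V →L[ℝ] E) =
      (mfderiv 𝓘(ℝ, E) 𝓘(ℝ, E) φ.symm (φ (f z')) : E →L[ℝ] E).comp
        (mfderiv 𝓘(ℝ, V) 𝓘(ℝ, E) (fun w => φ (f w)) z' : V →L[ℝ] E) :=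
    (Filter.EventuallyEq.mfderiv_eq (hz'.mono fun w hw => (φ.left_inv hw).symm)).trans
      (mfderiv_comp z' hψ (hφ.comp z' hfd))
  -- The tangent space depends on the base point, so equal points are exchanged by substitution,
  -- with all vectors viewed in `E`.
  have hα : ∀ p : M, p = f z' → ∀ v : Fin k → E, (α (f z') v : ℝ) = α p v := by
    rintro p rfl v; rfl
  rw [← mfderiv_eq_fderiv]
  ext v
  refine Eq.trans ?_ (hα _ (φ.left_inv hs) _)
  change α (f z') _ = α (f z') _
  congr 1
  ext i
  exact congrArg (fun L : V →L[ℝ] E => L (v i)) key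

theorem DForm.contDiffAt_inChart {k : ℕ} {α : DForm E M k}
    (hα : α.IsSmooth) (x : M) {y : E} (hy : y ∈ (extChartAt 𝓘(ℝ, E) x).target) :
    ContDiffAt ℝ ∞ (α.inChart x) y :=
  (hα x).contDiffAt ((isOpen_extChartAt_target x).mem_nhds hy)

theorem ContMDiffAt.contDiffAt_extChartAt_comp [IsManifold 𝓘(ℝ, E) ∞ M] {f : V → M} {z : V}
    (hf : ContMDiffAt 𝓘(ℝ, V) 𝓘(ℝ, E) ∞ f z) :
    ContDiffAt ℝ ∞ (fun w => extChartAt 𝓘(ℝ, E) (f z) (f w)) z :=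
  ((contMDiffAt_extChartAt (x := f z)).comp z hf).contDiffAt

/-- Exterior differentiation commutes with pullbacks. -/
theorem DForm.extDeriv_pullbackVec [IsManifold 𝓘(ℝ, E) ∞ M] {k : ℕ} {f : V → M}
    {α : DForm E M k} (hα : α.IsSmooth) {z : V} (hf : ContMDiffAt 𝓘(ℝ, V) 𝓘(ℝ, E) ∞ f z) :
    extDeriv (α.pullbackVec f) z = α.d.pullbackVec f z := by
  have hc := hf.contDiffAt_extChartAt_comp
  rw [Filter.EventuallyEq.extDeriv_eq (α.pullbackVec_eventuallyEq_inChart hf),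
    extDeriv_pullback (r := ∞) (f := fun w => extChartAt 𝓘(ℝ, E) (f z) (f w))
      ((contDiffAt_inChart hα (f z) (mem_extChartAt_target (f z))).differentiableAt (by simp)) hc
      minSmoothness_two_le_infty]
  have key : fderiv ℝ (fun w => extChartAt 𝓘(ℝ, E) (f z) (f w)) z =
      (mfderiv 𝓘(ℝ, E) 𝓘(ℝ, E) (extChartAt 𝓘(ℝ, E) (f z)) (f z)).comp
        (mfderiv 𝓘(ℝ, V) 𝓘(ℝ, E) f z) := by
    rw [← mfderiv_eq_fderiv]
    exact mfderiv_comp z (mdifferentiableAt_extChartAt (by simp))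
      (hf.mdifferentiableAt (by simp))
  rw [key]
  rfl

theorem DForm.contDiffAt_covPullback [IsManifold 𝓘(ℝ, E) ∞ M] {f : V → M}
    {α : DForm E M 1} (hα : α.IsSmooth) {z : V} (hf : ContMDiffAt 𝓘(ℝ, V) 𝓘(ℝ, E) ∞ f z) :
    ContDiffAt ℝ ∞ (α.covPullback f) z := by
  have hc := hf.contDiffAt_extChartAt_comp
  have h1 : ContDiffAt ℝ ∞ (fun w => (ContinuousAlternatingMap.ofSubsingletonLIE (𝕜 := ℝ) (E := E) (F := ℝ)
      (0 : Fin 1)).symm (α.inChart (f z) (extChartAt 𝓘(ℝ, E) (f z) (f w)))) z :=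
    (LinearIsometryEquiv.contDiff _).contDiffAt.comp z
      (f := fun w => α.inChart (f z) (extChartAt 𝓘(ℝ, E) (f z) (f w)))
      ((contDiffAt_inChart hα (f z) (mem_extChartAt_target (f z))).comp z
        (f := fun w => extChartAt 𝓘(ℝ, E) (f z) (f w)) hc)
  refine (h1.clm_comp (hc.fderiv_right (m := ∞) (by simp))).congr_of_eventuallyEq ?_
  filter_upwards [α.pullbackVec_eventuallyEq_inChart hf] with w hw
  rw [DForm.covPullback, hw]
  rfl

theorem DForm.contDiffAt_pullbackVec_one [IsManifold 𝓘(ℝ, E) ∞ M] {f : V → M}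
    {α : DForm E M 1} (hα : α.IsSmooth) {z : V} (hf : ContMDiffAt 𝓘(ℝ, V) 𝓘(ℝ, E) ∞ f z) :
    ContDiffAt ℝ ∞ (α.pullbackVec f) z :=
  ((ContinuousAlternatingMap.ofSubsingletonLIE (𝕜 := ℝ) (E := V) (F := ℝ) (0 : Fin 1)).contDiff.contDiffAt.comp z
    (contDiffAt_covPullback hα hf)).congr_of_eventuallyEq (Eventually.of_forall fun _ =>
      ((ContinuousAlternatingMap.ofSubsingleton ℝ V ℝ (0 : Fin 1)).apply_symm_apply _).symm)

/-- The exterior derivative of a 1-form is the antisymmetrized derivative of its coefficients. -/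
theorem DForm.d_apply_mfderiv [IsManifold 𝓘(ℝ, E) ∞ M] {f : V → M}
    {α : DForm E M 1} (hα : α.IsSmooth) {z : V} (hf : ContMDiffAt 𝓘(ℝ, V) 𝓘(ℝ, E) ∞ f z) (u v : V) :
    α.d (f z) ![mfderiv 𝓘(ℝ, V) 𝓘(ℝ, E) f z u, mfderiv 𝓘(ℝ, V) 𝓘(ℝ, E) f z v] =
      fderiv ℝ (α.covPullback f) z u v - fderiv ℝ (α.covPullback f) z v u := by
  have h1 : α.d (f z) ![mfderiv 𝓘(ℝ, V) 𝓘(ℝ, E) f z u, mfderiv 𝓘(ℝ, V) 𝓘(ℝ, E) f z v] =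
      α.d.pullbackVec f z ![u, v] := by
    rw [DForm.pullbackVec_apply]
    congr 1; ext i; fin_cases i <;> rfl
  have hs := (contDiffAt_covPullback hα hf).differentiableAt (by simp)
  have h2 : ∀ w a : V, fderiv ℝ (fun y => α.pullbackVec f y ![w]) z a =
      fderiv ℝ (α.covPullback f) z a w := by
    intro w a
    have : (fun y => α.pullbackVec f y ![w]) = fun y => α.covPullback f y w := by
      ext y
      change _ = α.pullbackVec f y fun _ => w
      congr 1; ext i; fin_cases i; rfl
    rw [this, fderiv_clm_apply hs (differentiableAt_const w)]
    simp
  rw [h1, ← extDeriv_pullbackVec hα hf, extDeriv_apply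
    ((contDiffAt_pullbackVec_one hα hf).differentiableAt (by simp)), Fin.sum_univ_two]
  have e0 : Fin.removeNth 0 ![u, v] = ![v] := by ext i; fin_cases i; rfl
  have e1 : Fin.removeNth 1 ![u, v] = ![u] := by ext i; fin_cases i; rfl
  rw [e0, e1, h2, h2]
  simp [sub_eq_add_neg]

theorem contDiffAt_extDeriv {k : ℕ} {β : V → V [⋀^Fin k]→L[ℝ] ℝ} {z : V}
    (hβ : ContDiffAt ℝ ∞ β z) : ContDiffAt ℝ ∞ (extDeriv β) z := by
  have h := hβ.fderiv_right (m := ∞) (by simp)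
  exact (ContinuousAlternatingMap.alternatizeUncurryFinCLM ℝ V ℝ).contDiff.contDiffAt.comp z h

theorem DForm.isSmooth_iff_contDiffAt {k : ℕ} {α : DForm E M k} :
    α.IsSmooth ↔ ∀ x : M, ∀ y ∈ (extChartAt 𝓘(ℝ, E) x).target, ContDiffAt ℝ ∞ (α.inChart x) y :=
  ⟨fun h x _ hy => contDiffAt_inChart h x hy, fun h x y hy => (h x y hy).contDiffWithinAt⟩

theorem DForm.IsSmooth.ofCovectors_add {ξ ζ : ∀ x : M, TangentSpace 𝓘(ℝ, E) x →L[ℝ] ℝ}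
    (hξ : (DForm.ofCovectors ξ).IsSmooth) (hζ : (DForm.ofCovectors ζ).IsSmooth) :
    (DForm.ofCovectors fun x => ξ x + ζ x).IsSmooth := fun x =>
  ((hξ x).add (hζ x)).congr fun _ _ => rfl

end PullbackToVectorSpace

/-! ### Angular coordinates on a circle bundle. -/

section PolarChart

/-- The determination near `Circle.exp s₀` of the angle, taking the value `s₀` there. -/
def Circle.angleNear (s₀ : ℝ) (c : Circle) : ℝ := s₀ + Complex.arg (c * Circle.exp (-s₀) : Circle)

theorem Circle.exp_angleNear (s₀ : ℝ) (c : Circle) : Circle.exp (Circle.angleNear s₀ c) = c := by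
  rw [Circle.angleNear, Circle.exp_add, Circle.exp_arg, mul_left_comm, ← Circle.exp_add]
  simp

theorem Circle.eventually_angleNear_exp (s₀ : ℝ) :
    ∀ᶠ s in 𝓝 s₀, Circle.angleNear s₀ (Circle.exp s) = s := by
  have h : ∀ᶠ s in 𝓝 s₀, s ∈ Ioo (s₀ - Real.pi) (s₀ + Real.pi) :=
    Ioo_mem_nhds (by linarith [Real.pi_pos]) (by linarith [Real.pi_pos])
  filter_upwards [h] with s hs
  rw [Circle.angleNear, ← Circle.exp_add, Circle.arg_exp (by linarith [hs.1]) (by linarith [hs.2])]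
  ring

/-- The rotation by `Circle.exp (-s₀)` moves the base point to `1`, away from the branch cut, where
`arg` is the imaginary part of the smooth function `log`. -/
theorem Circle.contMDiffAt_angleNear (s₀ : ℝ) :
    ContMDiffAt (𝓡 1) 𝓘(ℝ, ℝ) ∞ (Circle.angleNear s₀) (Circle.exp s₀) := by
  have := finrank_real_complex_fact'
  have h1 : ContMDiff (𝓡 1) 𝓘(ℝ, ℂ) ∞ (fun c : Circle => (c : ℂ)) :=
    contMDiff_coe_sphere (E := ℂ) (n := 1)
  have h2 : ContDiffAt ℝ ∞
      (fun z : ℂ => s₀ + Complex.arg (z * (Circle.exp (-s₀) : ℂ))) (Circle.exp s₀ : ℂ) := by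
    have h3 : (Circle.exp s₀ : ℂ) * (Circle.exp (-s₀) : ℂ) = 1 := by
      rw [← Circle.coe_mul, ← Circle.exp_add]; simp
    have h4 : ContDiffAt ℝ ∞ Complex.log ((Circle.exp s₀ : ℂ) * (Circle.exp (-s₀) : ℂ)) :=
      (Complex.contDiffAt_log (by rw [h3]; exact Complex.one_mem_slitPlane)).restrict_scalars ℝ
    have h5 : ContDiffAt ℝ ∞ (fun z : ℂ => Complex.log (z * (Circle.exp (-s₀) : ℂ)))
        (Circle.exp s₀ : ℂ) :=
      ContDiffAt.comp (g := Complex.log) (f := fun z : ℂ => z * (Circle.exp (-s₀) : ℂ)) _ h4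
        (contDiffAt_id.mul contDiffAt_const)
    have h6 := Complex.imCLM.contDiff.contDiffAt.comp _ h5
    refine contDiffAt_const.add (h6.congr_of_eventuallyEq (Eventually.of_forall fun z => ?_))
    simp [Complex.log_im]
  have h7 := h2.contMDiffAt.comp (Circle.exp s₀) h1.contMDiffAt
  exact h7

variable {E M EB B : Type*} [NormedAddCommGroup E] [NormedSpace ℝ E]
  [TopologicalSpace M] [ChartedSpace E M]
  [NormedAddCommGroup EB] [NormedSpace ℝ EB] [TopologicalSpace B] [ChartedSpace EB B]

/-- `F` parametrizes the part of the circle bundle `p : M → B` over the convex open set `W` of the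
chart around `b₀`, by the base coordinates and an angle. -/
structure IsPolarChart (p : M → B) (b₀ : B) (W : Set EB) (F : EB × ℝ → M) : Prop where
  isOpen : IsOpen W
  convex : Convex ℝ W
  subset : W ⊆ (extChartAt 𝓘(ℝ, EB) b₀).target
  mem : extChartAt 𝓘(ℝ, EB) b₀ b₀ ∈ W
  contMDiffAt : ∀ z, z.1 ∈ W → ContMDiffAt 𝓘(ℝ, EB × ℝ) 𝓘(ℝ, E) ∞ F z
  proj : ∀ z, z.1 ∈ W → p (F z) = (extChartAt 𝓘(ℝ, EB) b₀).symm z.1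
  eq_iff : ∀ y ∈ W, ∀ s s' : ℝ, F (y, s) = F (y, s') ↔ ∃ k : ℤ, s = s' + k * (2 * Real.pi)
  exists_angle : ∀ x, p x ∈ (extChartAt 𝓘(ℝ, EB) b₀).source → extChartAt 𝓘(ℝ, EB) b₀ (p x) ∈ W →
    ∃ s, F (extChartAt 𝓘(ℝ, EB) b₀ (p x), s) = x
  exists_inverse : ∀ z, z.1 ∈ W → ∃ τ : M → ℝ, ContMDiffAt 𝓘(ℝ, E) 𝓘(ℝ, ℝ) ∞ τ (F z) ∧
    (∀ᶠ x in 𝓝 (F z), F (extChartAt 𝓘(ℝ, EB) b₀ (p x), τ x) = x) ∧ ∀ᶠ w in 𝓝 z, τ (F w) = w.2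

theorem IsSmoothFiberBundle.contMDiff {EF F : Type*} [NormedAddCommGroup EF] [NormedSpace ℝ EF]
    [TopologicalSpace F] [ChartedSpace EF F] {p : M → B}
    (h : IsSmoothFiberBundle E EB EF F p) : ContMDiff 𝓘(ℝ, E) 𝓘(ℝ, EB) ∞ p := by
  intro x
  obtain ⟨e, he, hs, -⟩ := h (p x)
  have hx : x ∈ e.source := e.mem_source.2 he
  have h1 := (hs x hx).contMDiffAt (e.open_source.mem_nhds hx)
  refine (contMDiffAt_fst.comp x h1).congr_of_eventuallyEq ?_
  filter_upwards [e.open_source.mem_nhds hx] with y hy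
  exact (e.coe_fst hy).symm

variable [IsManifold 𝓘(ℝ, EB) ∞ B]

/-- `F` is the inverse trivialization composed with the inverse chart on the base and `Circle.exp`
on the fiber. Taking `W` to be a ball makes it convex, as the Poincaré lemma requires. -/
theorem IsSmoothFiberBundle.exists_isPolarChart {p : M → B}
    (h : IsSmoothFiberBundle E EB (EuclideanSpace ℝ (Fin 1)) Circle p) (b₀ : B) :
    ∃ (W : Set EB) (F : EB × ℝ → M), IsPolarChart (E := E) p b₀ W F := by
  have hp := h.contMDiff
  obtain ⟨e, hb, he, he'⟩ := h b₀
  set φ := extChartAt 𝓘(ℝ, EB) b₀ with hφ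
  have hb₀ : φ b₀ ∈ φ.target := mem_extChartAt_target b₀
  have hopen : IsOpen (φ.target ∩ φ.symm ⁻¹' e.baseSet) :=
    (continuousOn_extChartAt_symm b₀).isOpen_inter_preimage (isOpen_extChartAt_target b₀)
      e.open_baseSet
  have hmem : φ b₀ ∈ φ.target ∩ φ.symm ⁻¹' e.baseSet :=
    ⟨hb₀, by rw [mem_preimage, φ.left_inv (mem_extChartAt_source b₀)]; exact hb⟩
  obtain ⟨r, hr, hball⟩ := Metric.isOpen_iff.1 hopen _ hmem
  set W := Metric.ball (φ b₀) r with hW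
  have hWt : ∀ y ∈ W, y ∈ φ.target := fun y hy => (hball hy).1
  have hWb : ∀ y ∈ W, φ.symm y ∈ e.baseSet := fun y hy => (hball hy).2
  set F : EB × ℝ → M := fun z => e.toOpenPartialHomeomorph.symm (φ.symm z.1, Circle.exp z.2) with hF
  have hFs : ∀ z : EB × ℝ, z.1 ∈ W → F z ∈ e.source := fun z hz =>
    e.toOpenPartialHomeomorph.map_target (e.mem_target.2 (hWb _ hz))
  have heF : ∀ z : EB × ℝ, z.1 ∈ W → e (F z) = (φ.symm z.1, Circle.exp z.2) := fun z hz =>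
    e.apply_symm_apply (e.mem_target.2 (hWb _ hz))
  have hpF : ∀ z : EB × ℝ, z.1 ∈ W → p (F z) = φ.symm z.1 := fun z hz => by
    rw [← e.coe_fst (hFs z hz), heF z hz]
  have hFx : ∀ x s, p x ∈ φ.source → φ (p x) ∈ W → Circle.exp s = (e x).2 →
      F (φ (p x), s) = x := by
    intro x s h1 h2 h3
    have hx : x ∈ e.source := e.mem_source.2 (by simpa [φ.left_inv h1] using hWb _ h2)
    change e.toOpenPartialHomeomorph.symm (φ.symm (φ (p x)), Circle.exp s) = x
    rw [h3, φ.left_inv h1, ← e.coe_fst hx]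
    exact e.toOpenPartialHomeomorph.left_inv hx
  refine ⟨W, F, Metric.isOpen_ball, convex_ball _ _, fun y hy => hWt y hy,
    Metric.mem_ball_self hr, ?_, hpF, ?_, ?_, ?_⟩
  · intro z hz
    have h1 : ContMDiffAt 𝓘(ℝ, EB × ℝ) 𝓘(ℝ, EB) ∞ (fun z : EB × ℝ => φ.symm z.1) z :=
      ((contMDiffOn_extChartAt_symm b₀).contMDiffAt
        ((isOpen_extChartAt_target b₀).mem_nhds (hWt _ hz))).comp z
        contDiff_fst.contMDiff.contMDiffAt
    have h2 : ContMDiffAt 𝓘(ℝ, EB × ℝ) (𝓡 1) ∞ (fun z : EB × ℝ => Circle.exp z.2) z :=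
      contMDiff_circleExp.contMDiffAt.comp z contDiff_snd.contMDiff.contMDiffAt
    exact ((he' _ (e.mem_target.2 (hWb _ hz))).contMDiffAt
      (e.open_target.mem_nhds (e.mem_target.2 (hWb _ hz)))).comp z (h1.prodMk h2)
  · intro y hy s s'
    have : F (y, s) = F (y, s') ↔ Circle.exp s = Circle.exp s' := by
      constructor
      · intro hh
        have := congrArg e hh
        rw [heF (y, s) hy, heF (y, s') hy] at this
        exact congrArg Prod.snd this
      · intro hh
        simp only [hF, hh]
    rw [this, Circle.exp_eq_exp]
  · intro x hx hxW
    exact ⟨_, hFx x _ hx hxW (Circle.exp_arg _)⟩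
  · intro z hz
    have hφp : ContinuousAt (fun x => φ (p x)) (F z) := by
      have : ContinuousAt φ (p (F z)) := by
        apply continuousAt_extChartAt' (I := 𝓘(ℝ, EB)) (x := b₀)
        rw [hpF z hz]
        exact φ.map_target (hWt _ hz)
      exact this.comp hp.continuous.continuousAt
    have e1 : ∀ᶠ x in 𝓝 (F z), φ (p x) ∈ W := by
      refine hφp.eventually (Metric.isOpen_ball.mem_nhds ?_)
      change φ (p (F z)) ∈ W
      rw [hpF z hz, φ.right_inv (hWt _ hz)]; exact hz
    have e2 : ∀ᶠ x in 𝓝 (F z), p x ∈ φ.source := by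
      refine hp.continuous.continuousAt.eventually ((isOpen_extChartAt_source b₀).mem_nhds ?_)
      rw [hpF z hz]
      exact φ.map_target (hWt _ hz)
    -- The branch of the angle is centred at `z.2`, so that it recovers the angle itself near `z`
    -- and not merely its class modulo `2π`.
    refine ⟨fun x => Circle.angleNear z.2 (e x).2, ?_, ?_, ?_⟩
    · have h1 := (he _ (hFs z hz)).contMDiffAt (e.open_source.mem_nhds (hFs z hz))
      have h2 : ContMDiffAt (𝓡 1) 𝓘(ℝ, ℝ) ∞ (Circle.angleNear z.2) (e (F z)).2 := by
        rw [heF z hz]; exact Circle.contMDiffAt_angleNear z.2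
      exact ContMDiffAt.comp (g := Circle.angleNear z.2) (f := fun x => (e x).2) (F z) h2
        (contMDiffAt_snd.comp (F z) h1)
    · filter_upwards [e1, e2] with x h1 h2
      exact hFx x _ h2 h1 (Circle.exp_angleNear _ _)
    · have h1 : ∀ᶠ w : EB × ℝ in 𝓝 z, w.1 ∈ W :=
        continuousAt_fst.eventually (Metric.isOpen_ball.mem_nhds hz)
      have h2 := continuousAt_snd.eventually (Circle.eventually_angleNear_exp z.2)
      filter_upwards [h1, h2] with w hw1 hw2
      rw [heF w hw1]
      exact hw2

end PolarChart

/-! ### Straightening a 1-form on `W × ℝ` to the form `dt + A`. -/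

section Straightening

variable {V : Type*} [NormedAddCommGroup V] [NormedSpace ℝ V]

/-- The projection of `V × ℝ` onto `V × {0}`. -/
def dropSnd (V : Type*) [NormedAddCommGroup V] [NormedSpace ℝ V] : V × ℝ →L[ℝ] V × ℝ :=
  (ContinuousLinearMap.inl ℝ V ℝ).comp (ContinuousLinearMap.fst ℝ V ℝ)

@[simp]
theorem dropSnd_apply (u : V × ℝ) : dropSnd V u = (u.1, 0) := rfl

theorem eq_dropSnd_add_smul (u : V × ℝ) : u = dropSnd V u + u.2 • ((0 : V), (1 : ℝ)) := by
  ext <;> simp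

/-- A 1-form `β` on `W × ℝ` satisfying the regularity and invariance needed to straighten it:
it is periodic in the last variable, `dβ(∂ₛ, ·) = 0` and `β(∂ₛ)` vanishes nowhere. -/
structure IsStraightenable (W : Set V) (q : ℝ) (β : V × ℝ → V × ℝ →L[ℝ] ℝ) : Prop where
  isOpen : IsOpen W
  convex : Convex ℝ W
  nonempty : W.Nonempty
  period_pos : 0 < q
  contDiffAt : ∀ z, z.1 ∈ W → ContDiffAt ℝ ∞ β z
  periodic : ∀ y ∈ W, ∀ s, β (y, s + q) = β (y, s)
  ne_zero : ∀ z, z.1 ∈ W → β z (0, 1) ≠ 0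
  fderiv_symm : ∀ z, z.1 ∈ W → ∀ v, fderiv ℝ β z (0, 1) v = fderiv ℝ β z v (0, 1)

namespace IsStraightenable

variable {W : Set V} {q : ℝ} {β : V × ℝ → V × ℝ →L[ℝ] ℝ}

theorem isOpen_prod (h : IsStraightenable W q β) : IsOpen {z : V × ℝ | z.1 ∈ W} :=
  h.isOpen.preimage continuous_fst

theorem convex_prod (h : IsStraightenable W q β) : Convex ℝ {z : V × ℝ | z.1 ∈ W} :=
  h.convex.linear_preimage (LinearMap.fst ℝ V ℝ)

theorem eventually_mem (h : IsStraightenable W q β) {z : V × ℝ} (hz : z.1 ∈ W) :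
    ∀ᶠ w : V × ℝ in 𝓝 z, w.1 ∈ W := h.isOpen_prod.mem_nhds hz

theorem differentiableAt (h : IsStraightenable W q β) {z : V × ℝ} (hz : z.1 ∈ W) :
    DifferentiableAt ℝ β z := (h.contDiffAt z hz).differentiableAt (by simp)

theorem differentiableAt_fderiv (h : IsStraightenable W q β) {z : V × ℝ} (hz : z.1 ∈ W) :
    DifferentiableAt ℝ (fderiv ℝ β) z :=
  ((h.contDiffAt z hz).fderiv_right (m := ∞) (by simp)).differentiableAt (by simp)

theorem fderiv_fderiv_apply (h : IsStraightenable W q β) {z : V × ℝ} (hz : z.1 ∈ W)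
    (a u v : V × ℝ) :
    fderiv ℝ (fun w => fderiv ℝ β w u v) z a = fderiv ℝ (fderiv ℝ β) z a u v := by
  have h1 := h.differentiableAt_fderiv hz
  have h2 : DifferentiableAt ℝ (fun w => fderiv ℝ β w u) z :=
    h1.clm_apply (differentiableAt_const u)
  rw [fderiv_clm_apply h2 (differentiableAt_const v), fderiv_clm_apply h1 (differentiableAt_const u)]
  simp

/-- This is `L_{∂ₛ} dβ = 0` in coordinates. Differentiating `fderiv_symm` and using the symmetry of
second derivatives moves `∂ₛ` from the first slot to the last; the first two slots are then
symmetric. -/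
theorem fderiv_curl_eq_zero (h : IsStraightenable W q β) {z : V × ℝ} (hz : z.1 ∈ W)
    (u v : V × ℝ) : fderiv ℝ (fderiv ℝ β) z (0, 1) u v = fderiv ℝ (fderiv ℝ β) z (0, 1) v u := by
  have hs : IsSymmSndFDerivAt ℝ β z :=
    (h.contDiffAt z hz).isSymmSndFDerivAt minSmoothness_two_le_infty
  have key : ∀ a b : V × ℝ, fderiv ℝ (fderiv ℝ β) z (0, 1) a b =
      fderiv ℝ (fderiv ℝ β) z a b (0, 1) := by
    intro a b
    rw [hs.eq (0, 1) a, ← h.fderiv_fderiv_apply hz, ← h.fderiv_fderiv_apply hz]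
    have : (fun w => fderiv ℝ β w (0, 1) b) =ᶠ[𝓝 z] fun w => fderiv ℝ β w b (0, 1) := by
      filter_upwards [h.eventually_mem hz] with w hw
      exact h.fderiv_symm w hw b
    rw [this.fderiv_eq]
  rw [key u v, key v u, hs.eq u v]

/-- The exterior derivative of `β` does not depend on the last variable. -/
theorem curl_eq (h : IsStraightenable W q β) {y : V} (hy : y ∈ W) (s : ℝ) (u v : V × ℝ) :
    fderiv ℝ β (y, s) u v - fderiv ℝ β (y, s) v u =
      fderiv ℝ β (y, 0) u v - fderiv ℝ β (y, 0) v u := by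
  have hline : ∀ t : ℝ, HasDerivAt (fun t : ℝ => (y, t)) ((0 : V), (1 : ℝ)) t := fun t =>
    (hasDerivAt_const t y).prodMk (hasDerivAt_id t)
  have hd : ∀ t : ℝ, HasDerivAt
      (fun t => fderiv ℝ β (y, t) u v - fderiv ℝ β (y, t) v u) 0 t := by
    intro t
    have h0 : ∀ a b : V × ℝ, HasDerivAt (fun t => fderiv ℝ β (y, t) a b)
        (fderiv ℝ (fderiv ℝ β) (y, t) (0, 1) a b) t := by
      intro a b
      have h1 := h.differentiableAt_fderiv (z := (y, t)) hy
      have h2 : DifferentiableAt ℝ (fun w => fderiv ℝ β w a b) (y, t) :=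
        (h1.clm_apply (differentiableAt_const a)).clm_apply (differentiableAt_const b)
      rw [← h.fderiv_fderiv_apply (z := (y, t)) hy]
      exact h2.hasFDerivAt.comp_hasDerivAt t (hline t)
    have := (h0 u v).sub (h0 v u)
    rwa [h.fderiv_curl_eq_zero (z := (y, t)) hy u v, sub_self] at this
  exact is_const_of_deriv_eq_zero (fun t => (hd t).differentiableAt) (fun t => (hd t).deriv) s 0

/-- `dβ` is determined by its values on `V × {0}`. -/
theorem curl_eq_dropSnd (h : IsStraightenable W q β) {z : V × ℝ} (hz : z.1 ∈ W) (u v : V × ℝ) :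
    fderiv ℝ β z u v - fderiv ℝ β z v u =
      fderiv ℝ β (dropSnd V z) (dropSnd V u) (dropSnd V v) -
        fderiv ℝ β (dropSnd V z) (dropSnd V v) (dropSnd V u) := by
  have h1 := h.curl_eq hz z.2 (dropSnd V u) (dropSnd V v)
  refine Eq.trans ?_ h1
  change _ = fderiv ℝ β z _ _ - fderiv ℝ β z _ _
  conv_lhs => rw [eq_dropSnd_add_smul u, eq_dropSnd_add_smul v]
  simp only [map_add, map_smul, add_apply, smul_apply,
    smul_eq_mul]
  rw [h.fderiv_symm z hz (dropSnd V v), h.fderiv_symm z hz (dropSnd V u)]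
  ring

theorem hasFDerivAt_sub_dropSnd (h : IsStraightenable W q β) {z : V × ℝ} (hz : z.1 ∈ W) :
    DifferentiableAt ℝ (fun z => β z - (β (dropSnd V z)).comp (dropSnd V)) z ∧ ∀ u v,
      fderiv ℝ (fun z => β z - (β (dropSnd V z)).comp (dropSnd V)) z u v =
        fderiv ℝ β z u v - fderiv ℝ β (dropSnd V z) (dropSnd V u) (dropSnd V v) := by
  have h1 := (h.differentiableAt hz).hasFDerivAt
  have h2 : HasFDerivAt (fun z => β (dropSnd V z))
      ((fderiv ℝ β (dropSnd V z)).comp (dropSnd V)) z :=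
    (h.differentiableAt (z := dropSnd V z) hz).hasFDerivAt.comp z (dropSnd V).hasFDerivAt
  have h3 := h1.sub (h2.clm_comp (hasFDerivAt_const (dropSnd V) z))
  refine ⟨h3.differentiableAt, fun u v => ?_⟩
  rw [HasFDerivAt.fderiv (f := fun z => β z - (β (dropSnd V z)).comp (dropSnd V)) h3]
  simp

/-- By `curl_eq_dropSnd` the form `β` and the pullback of its restriction to `s = 0` have the same
exterior derivative. Their difference is closed, hence exact on the convex set `W × ℝ`. The
primitive serves as the new fiber coordinate. -/
theorem exists_primitive (h : IsStraightenable W q β) : ∃ T : V × ℝ → ℝ, ∀ z, z.1 ∈ W →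
    HasFDerivAt T (β z - (β (dropSnd V z)).comp (dropSnd V)) z := by
  refine h.convex_prod.exists_forall_hasFDerivAt_of_fderiv_symmetric h.isOpen_prod
    (fun z hz => (h.hasFDerivAt_sub_dropSnd hz).1.differentiableWithinAt) fun z hz u v => ?_
  rw [(h.hasFDerivAt_sub_dropSnd hz).2, (h.hasFDerivAt_sub_dropSnd hz).2]
  linarith [h.curl_eq_dropSnd hz u v]

variable {T : V × ℝ → ℝ}

theorem contDiffAt_primitive (h : IsStraightenable W q β)
    (hT : ∀ z, z.1 ∈ W → HasFDerivAt T (β z - (β (dropSnd V z)).comp (dropSnd V)) z)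
    {z : V × ℝ} (hz : z.1 ∈ W) : ContDiffAt ℝ ∞ T z := by
  have : ContDiffOn ℝ ∞ T {z | z.1 ∈ W} := by
    rw [contDiffOn_infty_iff_fderiv_of_isOpen h.isOpen_prod]
    refine ⟨fun w hw => (hT w hw).differentiableAt.differentiableWithinAt, fun w hw => ?_⟩
    refine ContDiffWithinAt.congr_of_mem (f := fun z => β z - (β (dropSnd V z)).comp (dropSnd V))
      ?_ (fun w hw => (hT w hw).fderiv) hw
    exact ((h.contDiffAt w hw).sub (((h.contDiffAt (dropSnd V w) hw).comp w
      (dropSnd V).contDiff.contDiffAt).clm_comp contDiffAt_const)).contDiffWithinAt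
  exact this.contDiffAt (h.isOpen_prod.mem_nhds hz)

theorem hasDerivAt_primitive
    (hT : ∀ z, z.1 ∈ W → HasFDerivAt T (β z - (β (dropSnd V z)).comp (dropSnd V)) z)
    {y : V} (hy : y ∈ W) (s : ℝ) : HasDerivAt (fun s => T (y, s)) (β (y, s) (0, 1)) s := by
  have := (hT (y, s) hy).comp_hasDerivAt s ((hasDerivAt_const s y).prodMk (hasDerivAt_id s))
  have e : (β (y, s) - (β (dropSnd V (y, s))).comp (dropSnd V)) (0, 1) = β (y, s) (0, 1) := by
    simp [Prod.mk_zero_zero]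
  rw [e] at this
  exact this

/-- By Rolle's theorem, equal values would force the derivative `β (y, s) (0, 1)` to vanish
somewhere. -/
theorem injective_primitive (h : IsStraightenable W q β)
    (hT : ∀ z, z.1 ∈ W → HasFDerivAt T (β z - (β (dropSnd V z)).comp (dropSnd V)) z)
    {y : V} (hy : y ∈ W) : Function.Injective fun s => T (y, s) := by
  have aux : ∀ a b : ℝ, a < b → T (y, a) ≠ T (y, b) := by
    intro a b hab heq
    obtain ⟨c, -, hc⟩ := exists_hasDerivAt_eq_zero hab
      (fun s _ => (hasDerivAt_primitive hT hy s).continuousAt.continuousWithinAt) heq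
      (fun s _ => hasDerivAt_primitive hT hy s)
    exact h.ne_zero (y, c) hy hc
  intro a b hab
  by_contra hne
  rcases lt_or_gt_of_ne hne with hlt | hlt
  · exact aux a b hlt hab
  · exact aux b a hlt hab.symm

/-- Periodicity of `β` makes the increment of `T` over one period have zero derivative in every
direction, including those of the base, so it is constant on the connected set `W × ℝ`. This is why
neighbouring orbits have equal periods. Injectivity of `T` along a fiber gives `c ≠ 0`. -/
theorem exists_period (h : IsStraightenable W q β)
    (hT : ∀ z, z.1 ∈ W → HasFDerivAt T (β z - (β (dropSnd V z)).comp (dropSnd V)) z) :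
    ∃ c : ℝ, c ≠ 0 ∧ ∀ y ∈ W, ∀ s, T (y, s + q) = T (y, s) + c := by
  have hd : ∀ z : V × ℝ, z.1 ∈ W →
      HasFDerivAt (fun z => T (z + ((0 : V), q)) - T z) (0 : V × ℝ →L[ℝ] ℝ) z := by
    intro z hz
    have h1 : HasFDerivAt (fun z => T (z + ((0 : V), q)))
        (β (z + ((0 : V), q)) - (β (dropSnd V (z + ((0 : V), q)))).comp (dropSnd V)) z := by
      exact (hasFDerivAt_comp_add_right ((0 : V), q)).2 (hT _ (by simpa using hz))
    have e1 : z + ((0 : V), q) = (z.1, z.2 + q) := by ext <;> simp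
    have e2 : β (z + ((0 : V), q)) - (β (dropSnd V (z + ((0 : V), q)))).comp (dropSnd V) -
        (β z - (β (dropSnd V z)).comp (dropSnd V)) = 0 := by
      rw [e1, h.periodic z.1 hz]
      simp
    exact e2 ▸ h1.sub (hT z hz)
  obtain ⟨y₀, hy₀⟩ := h.nonempty
  have hconst : ∀ z : V × ℝ, z.1 ∈ W →
      T (z + ((0 : V), q)) - T z = T ((y₀, 0) + ((0 : V), q)) - T (y₀, 0) := by
    intro z hz
    exact h.isOpen_prod.is_const_of_fderiv_eq_zero (𝕜 := ℝ) h.convex_prod.isPreconnected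
      (fun w hw => (hd w hw).differentiableAt.differentiableWithinAt)
      (fun w hw => (hd w hw).fderiv) hz (show ((y₀, (0 : ℝ)) : V × ℝ).1 ∈ W from hy₀)
  refine ⟨T ((y₀, 0) + ((0 : V), q)) - T (y₀, 0), ?_, fun y hy s => ?_⟩
  · intro h0
    have := h.injective_primitive hT hy₀ (a₁ := q) (a₂ := 0) (by simpa [sub_eq_zero] using h0)
    exact h.period_pos.ne' this
  · have := hconst (y, s) hy
    simp only [Prod.mk_add_mk, add_zero] at this ⊢
    linarith

theorem primitive_add_int_mul {Y : Type*} {W : Set Y} {q : ℝ} {T : Y × ℝ → ℝ} {c : ℝ} (hc : ∀ y ∈ W, ∀ s, T (y, s + q) = T (y, s) + c)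
    {y : Y} (hy : y ∈ W) (s : ℝ) (k : ℤ) : T (y, s + k * q) = T (y, s) + k * c := by
  induction k using Int.induction_on with
  | zero => simp
  | succ k ih =>
    have := hc y hy (s + k * q)
    push_cast at ih ⊢
    rw [show s + (k + 1) * q = s + k * q + q by ring, this, ih]; ring
  | pred k ih =>
    have := hc y hy (s + (-k - 1) * q)
    push_cast at ih ⊢
    rw [show s + (-k - 1) * q + q = s + -k * q by ring, ih] at this
    linarith

/-- The values `T (y, 0) + k * c` are unbounded in both directions, so the intermediate value
theorem applies. Completeness of the flow comes from here. -/
theorem surjective_primitive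
    (hT : ∀ z, z.1 ∈ W → HasFDerivAt T (β z - (β (dropSnd V z)).comp (dropSnd V)) z)
    {c : ℝ} (hc0 : c ≠ 0) (hc : ∀ y ∈ W, ∀ s, T (y, s + q) = T (y, s) + c)
    {y : V} (hy : y ∈ W) : Function.Surjective fun s => T (y, s) := by
  have hcont : Continuous fun s => T (y, s) :=
    continuous_iff_continuousAt.2 fun s => (hasDerivAt_primitive hT hy s).continuousAt
  have key : ∀ t : ℝ, ∃ k : ℤ, t ≤ T (y, 0) + k * c := by
    intro t
    rcases lt_or_gt_of_ne hc0 with h0 | h0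
    · obtain ⟨k, hk⟩ := exists_int_lt ((t - T (y, 0)) / c)
      exact ⟨k, by have := (lt_div_iff_of_neg h0).1 hk; linarith⟩
    · obtain ⟨k, hk⟩ := exists_int_gt ((t - T (y, 0)) / c)
      exact ⟨k, by have := (div_lt_iff₀ h0).1 hk; linarith⟩
  have key' : ∀ t : ℝ, ∃ k : ℤ, T (y, 0) + k * c ≤ t := by
    intro t
    -- Reflection in `T (y, 0)` turns the upper bound into a lower one, with `k` replaced by `-k`.
    obtain ⟨k, hk⟩ := key (2 * T (y, 0) - t)
    exact ⟨-k, by push_cast; linarith⟩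
  intro t
  obtain ⟨k, hk⟩ := key t
  obtain ⟨l, hl⟩ := key' t
  rw [← primitive_add_int_mul hc hy] at hk hl
  exact mem_range_of_exists_le_of_exists_ge hcont ⟨_, hl⟩ ⟨_, hk⟩

/-- The inverse of a map `(v, r) ↦ (v, L (v, r))` with `L (0, 1) ≠ 0`. -/
def shearEquiv (L : V × ℝ →L[ℝ] ℝ) (hL : L (0, 1) ≠ 0) : (V × ℝ) ≃L[ℝ] (V × ℝ) :=
  ContinuousLinearEquiv.equivOfInverse ((ContinuousLinearMap.fst ℝ V ℝ).prod L)
    ((ContinuousLinearMap.fst ℝ V ℝ).prod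
      ((L (0, 1))⁻¹ • (ContinuousLinearMap.snd ℝ V ℝ - L.comp (dropSnd V))))
    (by
      intro u
      have : L u = L (dropSnd V u) + u.2 * L (0, 1) := by
        conv_lhs => rw [eq_dropSnd_add_smul u]
        rw [map_add, map_smul, smul_eq_mul]
      ext
      · rfl
      · change (L (0, 1))⁻¹ * (L u - L (dropSnd V u)) = u.2
        rw [this]
        field_simp
        ring)
    (by
      intro u
      ext
      · rfl
      · have : L (u.1, (L (0, 1))⁻¹ * (u.2 - L (u.1, 0))) = u.2 := by
          rw [eq_dropSnd_add_smul (u.1, (L (0, 1))⁻¹ * (u.2 - L (u.1, 0))), map_add, map_smul]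
          simp
          field_simp
          ring
        simpa using this)

/-- The inverse function theorem applies to `(y, s) ↦ (y, T (y, s))`, whose derivative is an
invertible shear. Injectivity of `T` on each fiber identifies `S` with the second component of the
local inverse. -/
theorem contDiffAt_inverse [CompleteSpace V] (h : IsStraightenable W q β)
    (hT : ∀ z, z.1 ∈ W → HasFDerivAt T (β z - (β (dropSnd V z)).comp (dropSnd V)) z)
    {S : V × ℝ → ℝ} (hS : ∀ z, z.1 ∈ W → T (z.1, S z) = z.2)
    {z : V × ℝ} (hz : z.1 ∈ W) : ContDiffAt ℝ ∞ S z := by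
  set Θ : V × ℝ → V × ℝ := fun w => (w.1, T w)
  set a : V × ℝ := (z.1, S z)
  have ha : a.1 ∈ W := hz
  have hΘ : ContDiffAt ℝ ∞ Θ a := contDiffAt_fst.prodMk (h.contDiffAt_primitive hT ha)
  set L := β a - (β (dropSnd V a)).comp (dropSnd V)
  have hL : L (0, 1) ≠ 0 := by
    have : L (0, 1) = β a (0, 1) := by simp [L, Prod.mk_zero_zero]
    rw [this]; exact h.ne_zero a ha
  have hΘ' : HasFDerivAt Θ (shearEquiv L hL : V × ℝ →L[ℝ] V × ℝ) a :=
    hasFDerivAt_fst.prodMk (hT a ha)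
  have hΘa : Θ a = z := by ext <;> simp [Θ, a, hS z hz]
  have hloc := hΘ.to_localInverse hΘ' (by simp)
  have hr := (hΘ.hasStrictFDerivAt' hΘ' (by simp)).eventually_right_inverse
  change ∀ᶠ w in 𝓝 (Θ a), Θ (hΘ.localInverse hΘ' (by simp) w) = w at hr
  rw [hΘa] at hloc hr
  refine (contDiffAt_snd.comp z hloc).congr_of_eventuallyEq ?_
  filter_upwards [hr, h.eventually_mem hz] with w hw hwW
  have h1 : (hΘ.localInverse hΘ' (by simp) w).1 = w.1 := by
    change (Θ (hΘ.localInverse hΘ' (by simp) w)).1 = w.1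
    rw [hw]
  have h2 : T (hΘ.localInverse hΘ' (by simp) w) = w.2 := by
    change (Θ (hΘ.localInverse hΘ' (by simp) w)).2 = w.2
    rw [hw]
  refine h.injective_primitive hT hwW ?_
  change T (w.1, S w) = T (w.1, (hΘ.localInverse hΘ' (by simp) w).2)
  rw [hS w hwW, ← h1, ← h2]

/-- A coordinate change `T` of the last variable, with inverse `S`, which turns `β` into
`dt + A` with `A` a form on `V`. -/
theorem exists_straightening [CompleteSpace V] (h : IsStraightenable W q β) :
    ∃ (T S : V × ℝ → ℝ) (c : ℝ), c ≠ 0 ∧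
      (∀ z, z.1 ∈ W → HasFDerivAt T (β z - (β (dropSnd V z)).comp (dropSnd V)) z) ∧
      (∀ z, z.1 ∈ W → ContDiffAt ℝ ∞ T z) ∧ (∀ z, z.1 ∈ W → ContDiffAt ℝ ∞ S z) ∧
      (∀ z, z.1 ∈ W → T (z.1, S z) = z.2) ∧ (∀ z, z.1 ∈ W → S (z.1, T z) = z.2) ∧
      ∀ y ∈ W, ∀ (s : ℝ) (k : ℤ), T (y, s + k * q) = T (y, s) + k * c := by
  obtain ⟨T, hT⟩ := h.exists_primitive
  obtain ⟨c, hc0, hc⟩ := h.exists_period hT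
  have hex : ∀ z : V × ℝ, ∃ s, z.1 ∈ W → T (z.1, s) = z.2 := by
    intro z
    by_cases hz : z.1 ∈ W
    · obtain ⟨s, hs⟩ := surjective_primitive hT hc0 hc hz z.2
      exact ⟨s, fun _ => hs⟩
    · exact ⟨0, fun h => absurd h hz⟩
  choose S hS using hex
  refine ⟨T, S, c, hc0, hT, fun z hz => h.contDiffAt_primitive hT hz,
    fun z hz => h.contDiffAt_inverse hT hS hz, hS, fun z hz => ?_,
    fun y hy s k => primitive_add_int_mul hc hy s k⟩
  exact h.injective_primitive hT hz (hS (z.1, T z) hz)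

end IsStraightenable

end Straightening

/-! ### Algebra of alternating forms of low degree. -/

section AlternatingTwo

variable {F : Type*} [AddCommGroup F] [Module ℝ F] [TopologicalSpace F]

theorem ContinuousAlternatingMap.map_smul_one (μ : F [⋀^Fin 1]→L[ℝ] ℝ) (c : ℝ) (u : F) :
    μ ![c • u] = c * μ ![u] :=
  μ.toContinuousMultilinearMap.cons_smul ![] c u

theorem ContinuousAlternatingMap.map_smul_left (μ : F [⋀^Fin 2]→L[ℝ] ℝ) (c : ℝ) (u v : F) :
    μ ![c • u, v] = c * μ ![u, v] :=
  μ.toContinuousMultilinearMap.cons_smul ![v] c u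

theorem ContinuousAlternatingMap.map_sub_left (μ : F [⋀^Fin 2]→L[ℝ] ℝ) (u u' v : F) :
    μ ![u - u', v] = μ ![u, v] - μ ![u', v] := by
  have h1 : μ ![u + (-1 : ℝ) • u', v] = μ ![u, v] + μ ![(-1 : ℝ) • u', v] :=
    μ.toContinuousMultilinearMap.cons_add ![v] u _
  rw [sub_eq_add_neg, ← neg_one_smul ℝ u', h1, μ.map_smul_left]
  ring

theorem ContinuousAlternatingMap.map_swap_two (μ : F [⋀^Fin 2]→L[ℝ] ℝ) (u v : F) :
    μ ![u, v] = -μ ![v, u] := by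
  have := μ.map_swap ![v, u] (i := 0) (j := 1) (by decide)
  refine Eq.trans ?_ this
  change μ _ = μ _
  congr 1
  ext i
  fin_cases i <;> rfl

end AlternatingTwo

/-! ### The form and the vector field in polar coordinates. -/

section ReebPair

variable {E M EB B : Type*} [NormedAddCommGroup E] [NormedSpace ℝ E]
  [TopologicalSpace M] [ChartedSpace E M]
  [NormedAddCommGroup EB] [NormedSpace ℝ EB] [TopologicalSpace B] [ChartedSpace EB B]

/-- Here the target is modelled on the normed space `E₁ × E₂` itself rather than on a product of two
models. -/
theorem HasMFDerivAt.prodMk_vectorSpace {E₁ E₂ : Type*} [NormedAddCommGroup E₁] [NormedSpace ℝ E₁]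
    [NormedAddCommGroup E₂] [NormedSpace ℝ E₂] {f : M → E₁} {g : M → E₂} {x : M}
    {f' : TangentSpace 𝓘(ℝ, E) x →L[ℝ] E₁} {g' : TangentSpace 𝓘(ℝ, E) x →L[ℝ] E₂}
    (hf : HasMFDerivAt 𝓘(ℝ, E) 𝓘(ℝ, E₁) f x f') (hg : HasMFDerivAt 𝓘(ℝ, E) 𝓘(ℝ, E₂) g x g') :
    HasMFDerivAt 𝓘(ℝ, E) 𝓘(ℝ, E₁ × E₂) (fun x => (f x, g x)) x (f'.prod g') :=
  ⟨hf.1.prodMk hg.1, hf.2.prodMk hg.2⟩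

/-- A 1-form `η` and a vector field `R` tangent to the fibers of `p : M → B` with `η(R) = 1` and
`i_R dη = 0`. -/
structure IsReebPair (p : M → B) (R : ∀ x : M, TangentSpace 𝓘(ℝ, E) x) (η : DForm E M 1) :
    Prop where
  contMDiff_proj : ContMDiff 𝓘(ℝ, E) 𝓘(ℝ, EB) ∞ p
  smooth_form : η.IsSmooth
  apply_field : ∀ x, η x ![R x] = 1
  contraction : ∀ x (v : TangentSpace 𝓘(ℝ, E) x), η.d x ![R x, v] = 0
  vertical : ∀ x, mfderiv 𝓘(ℝ, E) 𝓘(ℝ, EB) p x (R x) = 0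

namespace IsPolarChart

variable {p : M → B} {b₀ : B} {W : Set EB} {F : EB × ℝ → M}

theorem mdifferentiableAt (hF : IsPolarChart (E := E) p b₀ W F) {z : EB × ℝ} (hz : z.1 ∈ W) :
    MDifferentiableAt 𝓘(ℝ, EB × ℝ) 𝓘(ℝ, E) F z :=
  (hF.contMDiffAt z hz).mdifferentiableAt (by simp)

theorem eventually_mem (hF : IsPolarChart (E := E) p b₀ W F) {z : EB × ℝ} (hz : z.1 ∈ W) :
    ∀ᶠ w : EB × ℝ in 𝓝 z, w.1 ∈ W :=
  continuousAt_fst.eventually (hF.isOpen.mem_nhds hz)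

theorem proj_mem_source (hF : IsPolarChart (E := E) p b₀ W F) {z : EB × ℝ} (hz : z.1 ∈ W) :
    p (F z) ∈ (extChartAt 𝓘(ℝ, EB) b₀).source := by
  rw [hF.proj z hz]; exact (extChartAt 𝓘(ℝ, EB) b₀).map_target (hF.subset hz)

theorem coord_proj (hF : IsPolarChart (E := E) p b₀ W F) {z : EB × ℝ} (hz : z.1 ∈ W) :
    extChartAt 𝓘(ℝ, EB) b₀ (p (F z)) = z.1 := by
  rw [hF.proj z hz, (extChartAt 𝓘(ℝ, EB) b₀).right_inv (hF.subset hz)]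

theorem apply_add_period (hF : IsPolarChart (E := E) p b₀ W F) {y : EB} (hy : y ∈ W) (s : ℝ) :
    F (y, s + 2 * Real.pi) = F (y, s) :=
  (hF.eq_iff y hy _ _).2 ⟨1, by simp⟩

variable [IsManifold 𝓘(ℝ, EB) ∞ B]

/-- Differentiating `x = F (φ (p x), τ x)`, with `φ` the chart at `b₀` and `τ` a local angle, gives
this with `r = dτ(v)`. In particular every vertical vector is a multiple of the image of `∂ₛ`. -/
theorem exists_mfderiv_eq (hF : IsPolarChart (E := E) p b₀ W F)
    (hp : ContMDiff 𝓘(ℝ, E) 𝓘(ℝ, EB) ∞ p) {z : EB × ℝ} (hz : z.1 ∈ W)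
    (v : TangentSpace 𝓘(ℝ, E) (F z)) : ∃ r : ℝ,
      mfderiv 𝓘(ℝ, EB × ℝ) 𝓘(ℝ, E) F z
        ((mfderiv 𝓘(ℝ, EB) 𝓘(ℝ, EB) (extChartAt 𝓘(ℝ, EB) b₀) (p (F z))
          (mfderiv 𝓘(ℝ, E) 𝓘(ℝ, EB) p (F z) v) : EB), r) = v := by
  obtain ⟨τ, hτ, h1, h2⟩ := hF.exists_inverse z hz
  set φ := extChartAt 𝓘(ℝ, EB) b₀ with hφ
  have hφd : MDifferentiableAt 𝓘(ℝ, EB) 𝓘(ℝ, EB) φ (p (F z)) :=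
    (contMDiffAt_extChartAt' (n := 1)
      (by rw [← extChartAt_source 𝓘(ℝ, EB)]; exact hF.proj_mem_source hz)).mdifferentiableAt
        (by simp)
  have hpd : MDifferentiableAt 𝓘(ℝ, E) 𝓘(ℝ, EB) p (F z) := hp.mdifferentiableAt (by simp)
  have hτd : MDifferentiableAt 𝓘(ℝ, E) 𝓘(ℝ, ℝ) τ (F z) := hτ.mdifferentiableAt (by simp)
  have hL := HasMFDerivAt.prodMk_vectorSpace (HasMFDerivAt.comp (F z) hφd.hasMFDerivAt hpd.hasMFDerivAt)
    hτd.hasMFDerivAt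
  have hz' : (φ (p (F z)), τ (F z)) = z := by
    ext
    · exact hF.coord_proj hz
    · exact h2.self_of_nhds
  have hFd : HasMFDerivAt 𝓘(ℝ, EB × ℝ) 𝓘(ℝ, E) F ((φ ∘ p) (F z), τ (F z))
      (mfderiv 𝓘(ℝ, EB × ℝ) 𝓘(ℝ, E) F z : EB × ℝ →L[ℝ] E) := by
    have key : ∀ z', z' = z → HasMFDerivAt 𝓘(ℝ, EB × ℝ) 𝓘(ℝ, E) F z'
        (mfderiv 𝓘(ℝ, EB × ℝ) 𝓘(ℝ, E) F z : EB × ℝ →L[ℝ] E) := by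
      rintro _ rfl
      exact (hF.mdifferentiableAt hz).hasMFDerivAt
    exact key _ hz'
  have hcomp := HasMFDerivAt.comp (F z) hFd hL
  have hid : HasMFDerivAt 𝓘(ℝ, E) 𝓘(ℝ, E) (F ∘ fun x => ((φ ∘ p) x, τ x)) (F z)
      (ContinuousLinearMap.id ℝ E) :=
    (hasMFDerivAt_id (F z)).congr_of_eventuallyEq h1
  have := hasMFDerivAt_unique hcomp hid
  exact ⟨mfderiv 𝓘(ℝ, E) 𝓘(ℝ, ℝ) τ (F z) v, congrArg (fun L : E →L[ℝ] E => L v) this⟩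

end IsPolarChart

end ReebPair

/-! ### Flow boxes, in which `η = dt + A` and `R = ∂ₜ`. -/

section FlowBox

variable {E M EB B : Type*} [NormedAddCommGroup E] [NormedSpace ℝ E]
  [TopologicalSpace M] [ChartedSpace E M]
  [NormedAddCommGroup EB] [NormedSpace ℝ EB] [TopologicalSpace B] [ChartedSpace EB B]
  {p : M → B} {R : ∀ x : M, TangentSpace 𝓘(ℝ, E) x} {η : DForm E M 1}
  {b₀ : B} {W : Set EB} {F : EB × ℝ → M}

namespace IsPolarChart

theorem covPullback_add_period (hF : IsPolarChart (E := E) p b₀ W F) (η : DForm E M 1) {y : EB}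
    (hy : y ∈ W) (s : ℝ) :
    η.covPullback F (y, s + 2 * Real.pi) = η.covPullback F (y, s) := by
  set a : EB × ℝ := (0, 2 * Real.pi)
  have hshift : HasMFDerivAt 𝓘(ℝ, EB × ℝ) 𝓘(ℝ, EB × ℝ) (fun w => w + a) (y, s)
      (ContinuousLinearMap.id ℝ (EB × ℝ)) :=
    ((hasFDerivAt_id (y, s)).add_const a).hasMFDerivAt
  have h1 : HasMFDerivAt 𝓘(ℝ, EB × ℝ) 𝓘(ℝ, E) F ((y, s) + a)
      (mfderiv 𝓘(ℝ, EB × ℝ) 𝓘(ℝ, E) F ((y, s) + a)) :=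
    (hF.mdifferentiableAt (by simpa [a] using hy)).hasMFDerivAt
  have h2 := HasMFDerivAt.comp (y, s) h1 hshift
  have h3 : F =ᶠ[𝓝 (y, s)] F ∘ fun w => w + a := by
    filter_upwards [hF.eventually_mem (z := (y, s)) hy] with w hw
    have e : w + a = (w.1, w.2 + 2 * Real.pi) := by ext <;> simp [a]
    change F w = F (w + a)
    rw [e]
    exact (hF.apply_add_period hw w.2).symm
  have h4 := (h2.congr_of_eventuallyEq h3).mfderiv
  have e : ((y, s) : EB × ℝ) + a = (y, s + 2 * Real.pi) := by simp [a]
  rw [← e]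
  refine ContinuousLinearMap.ext fun v => ?_
  rw [DForm.covPullback_apply, DForm.covPullback_apply]
  have h5 : mfderiv 𝓘(ℝ, EB × ℝ) 𝓘(ℝ, E) F (y, s) v =
    (mfderiv 𝓘(ℝ, EB × ℝ) 𝓘(ℝ, E) F ((y, s) + a) v : E) := congrArg (fun L : EB × ℝ →L[ℝ] E => L v) h4
  have h6 : F ((y, s) + a) = F (y, s) := by rw [e]; exact hF.apply_add_period hy s
  have key : ∀ x x' : M, x = x' → ∀ v v' : E, v = v' → (η x ![v] : ℝ) = η x' ![v'] := by
    rintro x _ rfl v _ rfl; rfl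
  exact key _ _ h6 _ _ h5.symm

variable [IsManifold 𝓘(ℝ, EB) ∞ B]

/-- The angular coordinate field is a multiple of `R`. -/
theorem mfderiv_angle (hF : IsPolarChart (E := E) p b₀ W F) (h : IsReebPair (EB := EB) p R η)
    {z : EB × ℝ} (hz : z.1 ∈ W) : η.covPullback F z (0, 1) ≠ 0 ∧
      mfderiv 𝓘(ℝ, EB × ℝ) 𝓘(ℝ, E) F z (0, 1) = η.covPullback F z (0, 1) • R (F z) := by
  obtain ⟨r, hr⟩ := hF.exists_mfderiv_eq h.contMDiff_proj hz (R (F z))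
  -- Verticality of `R` leaves only the angular component `r`, and `η(R) = 1` makes `r` the inverse
  -- of `η.covPullback F z (0, 1)`.
  rw [h.vertical, map_zero] at hr
  have hr' : r • mfderiv 𝓘(ℝ, EB × ℝ) 𝓘(ℝ, E) F z (0, 1) = R (F z) := by
    have e : (mfderiv 𝓘(ℝ, EB × ℝ) 𝓘(ℝ, E) F z (r • ((0 : EB), (1 : ℝ))) : E) =
      r • mfderiv 𝓘(ℝ, EB × ℝ) 𝓘(ℝ, E) F z ((0 : EB), (1 : ℝ)) := map_smul _ _ _
    rw [Prod.smul_mk, smul_zero, smul_eq_mul, mul_one] at e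
    exact e.symm.trans hr
  have h1 := h.apply_field (F z)
  rw [← hr', ContinuousAlternatingMap.map_smul_one, ← DForm.covPullback_apply] at h1
  refine ⟨right_ne_zero_of_mul_eq_one h1, ?_⟩
  rw [← hr', smul_smul, mul_comm, h1, one_smul]

variable [IsManifold 𝓘(ℝ, E) ∞ M]

/-- The condition `i_{∂ₛ} dβ = 0` is inherited from `i_R dη = 0`, as `∂ₛ` is mapped to a multiple of
`R`. -/
theorem isStraightenable (hF : IsPolarChart (E := E) p b₀ W F) (h : IsReebPair (EB := EB) p R η) :
    IsStraightenable W (2 * Real.pi) (η.covPullback F) where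
  isOpen := hF.isOpen
  convex := hF.convex
  nonempty := ⟨_, hF.mem⟩
  period_pos := Real.two_pi_pos
  contDiffAt z hz := DForm.contDiffAt_covPullback h.smooth_form (hF.contMDiffAt z hz)
  periodic y hy s := hF.covPullback_add_period η hy s
  ne_zero z hz := (hF.mfderiv_angle h hz).1
  fderiv_symm z hz v := by
    have := DForm.d_apply_mfderiv h.smooth_form (hF.contMDiffAt z hz) (0, 1) v
    rw [(hF.mfderiv_angle h hz).2, ContinuousAlternatingMap.map_smul_left, h.contraction,
      mul_zero] at this
    linarith

theorem d_apply_eq_dropSnd (hF : IsPolarChart (E := E) p b₀ W F)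
    (h : IsReebPair (EB := EB) p R η) {z : EB × ℝ} (hz : z.1 ∈ W) (u v : EB × ℝ) :
    η.d.pullbackVec F z ![u, v] =
      η.d.pullbackVec F (dropSnd EB z) ![dropSnd EB u, dropSnd EB v] := by
  have key : ∀ (z : EB × ℝ), z.1 ∈ W → ∀ u v : EB × ℝ, η.d.pullbackVec F z ![u, v] =
      fderiv ℝ (η.covPullback F) z u v - fderiv ℝ (η.covPullback F) z v u := by
    intro z hz u v
    rw [← DForm.d_apply_mfderiv h.smooth_form (hF.contMDiffAt z hz), DForm.pullbackVec_apply]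
    congr 1
    ext i
    fin_cases i <;> rfl
  rw [key z hz, key (dropSnd EB z) hz, (hF.isStraightenable h).curl_eq_dropSnd hz]

/-- At each point of the base, `dη` descends to a 2-form. -/
theorem exists_d_eq_comp (hF : IsPolarChart (E := E) p b₀ W F) (h : IsReebPair (EB := EB) p R η) :
    ∃ μ : TangentSpace 𝓘(ℝ, EB) b₀ [⋀^Fin 2]→L[ℝ] ℝ, ∀ x, p x = b₀ →
      ∀ v : Fin 2 → TangentSpace 𝓘(ℝ, E) x, η.d x v =
        μ fun i => (mfderiv 𝓘(ℝ, E) 𝓘(ℝ, EB) p x (v i) : EB) := by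
  set φ := extChartAt 𝓘(ℝ, EB) b₀ with hφ
  -- The candidate is `dη` at angle `0`. Independence of the angle makes it valid along the whole
  -- fiber.
  refine ⟨(η.d.pullbackVec F (φ b₀, 0)).compContinuousLinearMap
    ((ContinuousLinearMap.inl ℝ EB ℝ).comp
      (mfderiv 𝓘(ℝ, EB) 𝓘(ℝ, EB) φ b₀ : EB →L[ℝ] EB)), ?_⟩
  rintro x hx v
  obtain ⟨s, hs⟩ := hF.exists_angle x (by rw [hx]; exact mem_extChartAt_source b₀)
    (by rw [hx]; exact hF.mem)
  rw [hx] at hs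
  have hz : ((φ b₀, s) : EB × ℝ).1 ∈ W := hF.mem
  subst hs
  choose r hr using fun i => hF.exists_mfderiv_eq h.contMDiff_proj hz (v i)
  have hv : ∀ w : Fin 2 → TangentSpace 𝓘(ℝ, E) (F (φ b₀, s)), η.d (F (φ b₀, s)) w =
      η.d (F (φ b₀, s)) ![w 0, w 1] := by
    intro w; congr 1; ext i; fin_cases i <;> rfl
  have e1 : η.d (F (φ b₀, s)) v = η.d.pullbackVec F (φ b₀, s)
      ![((mfderiv 𝓘(ℝ, EB) 𝓘(ℝ, EB) φ (p (F (φ b₀, s)))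
          (mfderiv 𝓘(ℝ, E) 𝓘(ℝ, EB) p (F (φ b₀, s)) (v 0)) : EB), r 0),
        ((mfderiv 𝓘(ℝ, EB) 𝓘(ℝ, EB) φ (p (F (φ b₀, s)))
          (mfderiv 𝓘(ℝ, E) 𝓘(ℝ, EB) p (F (φ b₀, s)) (v 1)) : EB), r 1)] := by
    rw [DForm.pullbackVec_apply]
    congr 1
    ext i
    fin_cases i
    · exact (hr 0).symm
    · exact (hr 1).symm
  rw [e1, hF.d_apply_eq_dropSnd h hz]
  change _ = η.d.pullbackVec F (φ b₀, 0) _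
  congr 1
  ext i : 1
  have key : ∀ b, b = b₀ → ∀ w : EB,
      (mfderiv 𝓘(ℝ, EB) 𝓘(ℝ, EB) φ b w : EB) = mfderiv 𝓘(ℝ, EB) 𝓘(ℝ, EB) φ b₀ w := by
    rintro _ rfl w; rfl
  fin_cases i
  · exact Prod.ext (key _ hx _) rfl
  · exact Prod.ext (key _ hx _) rfl

end IsPolarChart

/-- A local parametrization `σ (b, t)` of `M` by the flow time along `R`, starting at a section,
in which `η = dt + A`. -/
structure IsFlowBox (p : M → B) (R : ∀ x : M, TangentSpace 𝓘(ℝ, E) x) (η : DForm E M 1)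
    (U : Set B) (γ : ℝ) (σ : B × ℝ → M) : Prop where
  isOpen : IsOpen U
  pos : 0 < γ
  contMDiffAt : ∀ z, z.1 ∈ U → ContMDiffAt (𝓘(ℝ, EB).prod 𝓘(ℝ, ℝ)) 𝓘(ℝ, E) ∞ σ z
  proj : ∀ z, z.1 ∈ U → p (σ z) = z.1
  curve : ∀ b ∈ U, IsMIntegralCurve (fun t => σ (b, t)) R
  eq_iff : ∀ b ∈ U, ∀ t t' : ℝ, σ (b, t) = σ (b, t') ↔ (t : AddCircle γ) = t'
  exists_time : ∀ x, p x ∈ U → ∃ τ : M → ℝ, ContMDiffAt 𝓘(ℝ, E) 𝓘(ℝ, ℝ) ∞ τ x ∧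
    ∀ᶠ x' in 𝓝 x, σ (p x', τ x') = x'
  form : ∀ b ∈ U, ∃ A : EB → ℝ, ∀ (t : ℝ) (w : TangentSpace (𝓘(ℝ, EB).prod 𝓘(ℝ, ℝ)) (b, t)),
    η (σ (b, t)) ![mfderiv (𝓘(ℝ, EB).prod 𝓘(ℝ, ℝ)) 𝓘(ℝ, E) σ (b, t) w] = w.2 + A w.1

theorem AddCircle.coe_eq_coe_iff_exists_int (γ t t' : ℝ) :
    (t : AddCircle γ) = t' ↔ ∃ k : ℤ, t = t' + k * γ := by
  rw [← sub_eq_zero, ← AddCircle.coe_sub, AddCircle.coe_eq_zero_iff]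
  refine exists_congr fun k => ?_
  rw [zsmul_eq_mul]
  constructor <;> intro h <;> linarith

/-- The constant `c` is negative when the angle runs against `R`; the period is then `|c|`. -/
theorem AddCircle.coe_eq_coe_abs_iff_exists_int (c t t' : ℝ) :
    (t : AddCircle |c|) = t' ↔ ∃ k : ℤ, t = t' + k * c := by
  rw [AddCircle.coe_eq_coe_iff_exists_int]
  rcases abs_choice c with h | h <;> rw [h]
  constructor
  · rintro ⟨k, hk⟩; exact ⟨-k, by push_cast; linarith⟩
  · rintro ⟨k, hk⟩; exact ⟨-k, by push_cast; linarith⟩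

variable [IsManifold 𝓘(ℝ, EB) ∞ B] [IsManifold 𝓘(ℝ, E) ∞ M] [CompleteSpace EB]

/-- The box is `σ (b, t) = F (φ b, S (φ b, t))`: the angle is replaced by the straightening
coordinate, which is the time along `R`. -/
theorem IsPolarChart.exists_isFlowBox (hF : IsPolarChart (E := E) p b₀ W F)
    (h : IsReebPair (EB := EB) p R η) : ∃ (U : Set B) (γ : ℝ) (σ : B × ℝ → M),
      b₀ ∈ U ∧ IsFlowBox (EB := EB) p R η U γ σ := by
  have hβ := hF.isStraightenable h
  obtain ⟨T, S, c, hc, hT, hTs, hSs, hTS, hST, hTc⟩ := hβ.exists_straightening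
  set φ := extChartAt 𝓘(ℝ, EB) b₀ with hφ
  set U := φ.source ∩ φ ⁻¹' W with hU
  have hUo : IsOpen U :=
    (continuousOn_extChartAt b₀).isOpen_inter_preimage (isOpen_extChartAt_source b₀) hF.isOpen
  set g : B × ℝ → EB × ℝ := fun z => (φ z.1, S (φ z.1, z.2)) with hg
  have hφs : ∀ b ∈ U, ContMDiffAt 𝓘(ℝ, EB) 𝓘(ℝ, EB) ∞ φ b := fun b hb =>
    contMDiffAt_extChartAt' (by rw [← extChartAt_source 𝓘(ℝ, EB)]; exact hb.1)
  have hg1 : ∀ z : B × ℝ, z.1 ∈ U →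
      ContMDiffAt (𝓘(ℝ, EB).prod 𝓘(ℝ, ℝ)) 𝓘(ℝ, EB) ∞ (fun z : B × ℝ => φ z.1) z := fun z hz =>
    (hφs z.1 hz).comp z contMDiffAt_fst
  have hgs : ∀ z : B × ℝ, z.1 ∈ U →
      ContMDiffAt (𝓘(ℝ, EB).prod 𝓘(ℝ, ℝ)) 𝓘(ℝ, EB × ℝ) ∞ g z := by
    intro z hz
    have h1 : ContMDiffAt (𝓘(ℝ, EB).prod 𝓘(ℝ, ℝ)) 𝓘(ℝ, EB × ℝ) ∞
        (fun z : B × ℝ => (φ z.1, z.2)) z := (hg1 z hz).prodMk_space contMDiffAt_snd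
    exact (hg1 z hz).prodMk_space
      (ContMDiffAt.comp (g := S) z (hSs (φ z.1, z.2) hz.2).contMDiffAt h1)
  have hgT : ∀ z : B × ℝ, z.1 ∈ U → T (g z) = z.2 := fun z hz => hTS (φ z.1, z.2) hz.2
  have hcurve : ∀ y ∈ W, IsMIntegralCurve (fun t => F (y, S (y, t))) R := by
    intro y hy t
    have hline : HasDerivAt (fun t : ℝ => (y, t)) ((0 : EB), (1 : ℝ)) t :=
      (hasDerivAt_const t y).prodMk (hasDerivAt_id t)
    have h1 : HasDerivAt (fun t => S (y, t)) (fderiv ℝ S (y, t) (0, 1)) t :=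
      ((hSs (y, t) hy).differentiableAt (by simp)).hasFDerivAt.comp_hasDerivAt t hline
    -- Differentiating `T (y, S (y, t)) = t` gives `β(∂ₛ) · ∂ₜS = 1`, so the velocity `∂ₜS · β(∂ₛ) •
    -- R` is exactly `R`.
    have h2 := (IsStraightenable.hasDerivAt_primitive hT hy (S (y, t))).comp t h1
    have h3 : HasDerivAt (fun t : ℝ => t) 1 t := hasDerivAt_id t
    have h4 := h2.unique (h3.congr_of_eventuallyEq
      (Eventually.of_forall fun t' => hTS (y, t') hy))
    have h5 := ((hasDerivAt_const t y).prodMk h1).hasFDerivAt.hasMFDerivAt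
    have h6 := HasMFDerivAt.comp t (hF.mdifferentiableAt (z := (y, S (y, t))) hy).hasMFDerivAt h5
    refine h6.congr_mfderiv ?_
    ext
    set r := fderiv ℝ S (y, t) (0, 1)
    have h7 : (mfderiv 𝓘(ℝ, EB × ℝ) 𝓘(ℝ, E) F (y, S (y, t)) ((1 : ℝ) • ((0 : EB), r)) : E) =
        (1 : ℝ) • R (F (y, S (y, t))) := by
      have e : ((1 : ℝ) • ((0 : EB), r)) = r • ((0 : EB), (1 : ℝ)) := by simp
      rw [e]
      have h8 : mfderiv 𝓘(ℝ, EB × ℝ) 𝓘(ℝ, E) F (y, S (y, t)) (r • ((0 : EB), (1 : ℝ))) =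
        r • mfderiv 𝓘(ℝ, EB × ℝ) 𝓘(ℝ, E) F (y, S (y, t)) ((0 : EB), (1 : ℝ)) := map_smul _ _ _
      rw [h8, (hF.mfderiv_angle h (z := (y, S (y, t))) hy).2, smul_smul, mul_comm, h4]
    exact h7
  refine ⟨U, |c|, fun z => F (g z), ⟨mem_extChartAt_source b₀, hF.mem⟩, hUo, abs_pos.2 hc,
    fun z hz => (hF.contMDiffAt (g z) hz.2).comp z (hgs z hz), fun z hz => ?_,
    fun b hb => hcurve _ hb.2, fun b hb t t' => ?_, fun x hx => ?_, fun b hb => ?_⟩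
  · rw [hF.proj (g z) hz.2]; exact φ.left_inv hz.1
  -- Adding `k` full turns to the angle adds `k * c` to the time.
  · rw [AddCircle.coe_eq_coe_abs_iff_exists_int, hF.eq_iff _ hb.2]
    refine exists_congr fun k => ⟨fun hk => ?_, fun hk => ?_⟩
    · have h1 := hTS (φ b, t) hb.2
      have h2 := hTS (φ b, t') hb.2
      simp only at h1 h2
      rw [← h1, hk, hTc _ hb.2, h2]
    · have h1 := hTc (φ b) hb.2 (S (φ b, t')) k
      have h2 := hTS (φ b, t') hb.2
      simp only at h2
      rw [h2, ← hk] at h1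
      have h3 := hST (φ b, S (φ b, t') + k * (2 * Real.pi)) hb.2
      simp only [h1] at h3
      exact h3
  · obtain ⟨s, hs⟩ := hF.exists_angle x hx.1 hx.2
    obtain ⟨τ, hτ, hτ', -⟩ := hF.exists_inverse (φ (p x), s) hx.2
    change ContMDiffAt _ _ _ τ (F (extChartAt 𝓘(ℝ, EB) b₀ (p x), s)) at hτ
    rw [hs] at hτ hτ'
    have h1 : ContMDiffAt 𝓘(ℝ, E) 𝓘(ℝ, EB × ℝ) ∞ (fun x => (φ (p x), τ x)) x :=
      ((hφs _ hx).comp x h.contMDiff_proj.contMDiffAt).prodMk_space hτ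
    refine ⟨fun x => T (φ (p x), τ x),
      ContMDiffAt.comp (g := T) x (hTs (φ (p x), τ x) hx.2).contMDiffAt h1, ?_⟩
    have h2 : ∀ᶠ x' in 𝓝 x, p x' ∈ U :=
      h.contMDiff_proj.continuous.continuousAt.eventually (hUo.mem_nhds hx)
    filter_upwards [hτ', h2] with x' h3 h4
    have h5 := hST (φ (p x'), τ x') h4.2
    simp only [hg]
    simp only at h5
    rw [h5]; exact h3
  -- `A` is the restriction of `β` to angle `0`. Differentiating `T ∘ g = Prod.snd` gives `(β -
  -- A)(w') = w.2`.
  · refine ⟨fun w => η.covPullback F (φ b, 0) (mfderiv 𝓘(ℝ, EB) 𝓘(ℝ, EB) φ b w, 0),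
      fun t w => ?_⟩
    have hgd := (hgs (b, t) hb).mdifferentiableAt (by simp)
    have hFd := hF.mdifferentiableAt (z := g (b, t)) hb.2
    set w' : EB × ℝ := mfderiv (𝓘(ℝ, EB).prod 𝓘(ℝ, ℝ)) 𝓘(ℝ, EB × ℝ) g (b, t) w with hw'
    have e1 : mfderiv (𝓘(ℝ, EB).prod 𝓘(ℝ, ℝ)) 𝓘(ℝ, E) (fun z => F (g z)) (b, t) w =
        mfderiv 𝓘(ℝ, EB × ℝ) 𝓘(ℝ, E) F (g (b, t)) w' :=
      mfderiv_comp_apply (b, t) hFd hgd w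
    rw [e1, ← DForm.covPullback_apply]
    have hTd : HasMFDerivAt 𝓘(ℝ, EB × ℝ) 𝓘(ℝ, ℝ) T (g (b, t)) _ := (hT (g (b, t)) hb.2).hasMFDerivAt
    have e2 := HasMFDerivAt.comp (b, t) hTd hgd.hasMFDerivAt
    have hUev : ∀ᶠ z : B × ℝ in 𝓝 (b, t), z.1 ∈ U :=
      continuousAt_fst.eventually (hUo.mem_nhds hb)
    have e3 : HasMFDerivAt (𝓘(ℝ, EB).prod 𝓘(ℝ, ℝ)) 𝓘(ℝ, ℝ) (T ∘ g) (b, t)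
        (ContinuousLinearMap.snd ℝ EB ℝ) :=
      (hasMFDerivAt_snd (I := 𝓘(ℝ, EB)) (I' := 𝓘(ℝ, ℝ)) (b, t)).congr_of_eventuallyEq
        (hUev.mono fun z hz => hgT z hz)
    have e4 := congrArg (fun L : EB × ℝ →L[ℝ] ℝ => L w) (hasMFDerivAt_unique e2 e3)
    have e5 : (η.covPullback F (g (b, t)) - (η.covPullback F (dropSnd EB (g (b, t)))).comp
      (dropSnd EB)) w' = w.2 := e4
    have hgf : HasMFDerivAt (𝓘(ℝ, EB).prod 𝓘(ℝ, ℝ)) 𝓘(ℝ, EB) (fun z : B × ℝ => φ z.1) (b, t)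
        ((ContinuousLinearMap.fst ℝ EB ℝ).comp
          (mfderiv (𝓘(ℝ, EB).prod 𝓘(ℝ, ℝ)) 𝓘(ℝ, EB × ℝ) g (b, t))) :=
      HasMFDerivAt.comp (g := Prod.fst) (f := g) (b, t)
        (hasFDerivAt_fst (𝕜 := ℝ) (E := EB) (F := ℝ) (p := g (b, t))).hasMFDerivAt hgd.hasMFDerivAt
    have hgf' : HasMFDerivAt (𝓘(ℝ, EB).prod 𝓘(ℝ, ℝ)) 𝓘(ℝ, EB) (fun z : B × ℝ => φ z.1) (b, t)
        ((mfderiv 𝓘(ℝ, EB) 𝓘(ℝ, EB) φ b).comp (ContinuousLinearMap.fst ℝ EB ℝ)) :=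
      HasMFDerivAt.comp (b, t) ((hφs b hb).mdifferentiableAt (by simp)).hasMFDerivAt
        (hasMFDerivAt_fst (b, t))
    have e6 : w'.1 = (mfderiv 𝓘(ℝ, EB) 𝓘(ℝ, EB) φ b w.1 : EB) :=
      congrArg (fun L : EB × ℝ →L[ℝ] EB => L w) (hasMFDerivAt_unique hgf hgf')
    have e7 : η.covPullback F (g (b, t)) w' - η.covPullback F (φ b, 0) (w'.1, 0) = w.2 := e5
    rw [e6] at e7
    linarith

end FlowBox

/-! ### Completeness of `R` and the common period. -/

section GlobalFlow

variable {E M EB B : Type*} [NormedAddCommGroup E] [NormedSpace ℝ E]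
  [TopologicalSpace M] [ChartedSpace E M]
  [NormedAddCommGroup EB] [NormedSpace ℝ EB] [TopologicalSpace B] [ChartedSpace EB B]
  {p : M → B} {R : ∀ x : M, TangentSpace 𝓘(ℝ, E) x} {η : DForm E M 1}
  {U : Set B} {γ : ℝ} {σ : B × ℝ → M}

theorem IsFlowBox.exists_eq (h : IsFlowBox (EB := EB) p R η U γ σ) {x : M} (hx : p x ∈ U) :
    ∃ t, σ (p x, t) = x := by
  obtain ⟨τ, -, hτ⟩ := h.exists_time x hx
  exact ⟨τ x, hτ.self_of_nhds⟩

/-- Each point lies on a curve of a flow box, which is an integral curve defined on all of `ℝ`.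
Uniqueness of integral curves yields the group law and the translation formula in the boxes. -/
theorem exists_isGlobalFlow [IsManifold 𝓘(ℝ, E) 1 M] [T2Space M]
    (hR : ContMDiff 𝓘(ℝ, E) 𝓘(ℝ, E).tangent 1 (fun x => (⟨x, R x⟩ : TangentBundle 𝓘(ℝ, E) M)))
    (hbox : ∀ b, ∃ (U : Set B) (γ : ℝ) (σ : B × ℝ → M), b ∈ U ∧
      IsFlowBox (EB := EB) p R η U γ σ) :
    ∃ θ : ℝ → M → M, IsGlobalFlow R θ ∧ (∀ s t x, θ (s + t) x = θ s (θ t x)) ∧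
      ∀ (U : Set B) (γ : ℝ) (σ : B × ℝ → M), IsFlowBox (EB := EB) p R η U γ σ →
        ∀ b ∈ U, ∀ t t', θ t (σ (b, t')) = σ (b, t' + t) := by
  have hex : ∀ x, ∃ c : ℝ → M, c 0 = x ∧ IsMIntegralCurve c R := by
    intro x
    obtain ⟨U, γ, σ, hx, h⟩ := hbox (p x)
    obtain ⟨t, ht⟩ := h.exists_eq hx
    exact ⟨(fun s => σ (p x, s)) ∘ fun s => s + t, by simpa using ht, (h.curve _ hx).comp_add t⟩
  choose c hc0 hc using hex
  have huniq : ∀ (x : M) (c' : ℝ → M) (t' : ℝ), IsMIntegralCurve c' R → c' t' = x →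
      ∀ t, c x t = c' (t' + t) := by
    intro x c' t' hc' hx t
    have h1 := isMIntegralCurve_Ioo_eq_of_contMDiff_boundaryless (t₀ := 0) hR (hc x)
      (hc'.comp_add t') (by simp [hc0, hx])
    rw [h1]
    simp [add_comm]
  refine ⟨fun t x => c x t, fun x => ⟨hc0 x, hc x⟩, fun s t x => ?_, fun U γ σ h b hb t t' => ?_⟩
  · have := huniq (c x t) (c x) t (hc x) rfl s
    rw [add_comm] at this
    exact this.symm
  · exact huniq (σ (b, t')) _ t' (h.curve b hb) rfl t

theorem IsFlowBox.flow_eq_iff (h : IsFlowBox (EB := EB) p R η U γ σ) {θ : ℝ → M → M}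
    (hθ : ∀ b ∈ U, ∀ t t', θ t (σ (b, t')) = σ (b, t' + t)) {x : M} (hx : p x ∈ U) (t t' : ℝ) :
    θ t x = θ t' x ↔ (t : AddCircle γ) = t' := by
  obtain ⟨s, hs⟩ := h.exists_eq hx
  rw [← hs, hθ _ hx, hθ _ hx, h.eq_iff _ hx, AddCircle.coe_add, AddCircle.coe_add, add_right_inj]

theorem AddCircle.isLeast_pos_coe_eq_zero {γ : ℝ} (hγ : 0 < γ) :
    IsLeast {T : ℝ | 0 < T ∧ (T : AddCircle γ) = 0} γ := by
  refine ⟨⟨hγ, AddCircle.coe_period γ⟩, fun T ⟨hT, hT0⟩ => ?_⟩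
  obtain ⟨k, hk⟩ := (AddCircle.coe_eq_zero_iff γ).1 hT0
  rw [zsmul_eq_mul] at hk
  have h1 : (0 : ℝ) < k := by
    by_contra hneg
    have := mul_nonpos_of_nonpos_of_nonneg (not_lt.1 hneg) hγ.le
    linarith
  have h2 : (1 : ℤ) ≤ k := by exact_mod_cast h1
  have h3 : (1 : ℝ) ≤ k := by exact_mod_cast h2
  nlinarith

/-- On a connected manifold all orbits have the same period. -/
theorem exists_common_period [ConnectedSpace M] (hp : Continuous p) {θ : ℝ → M → M}
    (hbox : ∀ b, ∃ (U : Set B) (γ : ℝ) (σ : B × ℝ → M), b ∈ U ∧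
      IsFlowBox (EB := EB) p R η U γ σ)
    (hθ : ∀ (U : Set B) (γ : ℝ) (σ : B × ℝ → M), IsFlowBox (EB := EB) p R η U γ σ →
        ∀ b ∈ U, ∀ t t', θ t (σ (b, t')) = σ (b, t' + t)) :
    ∃ γ : ℝ, 0 < γ ∧ ∀ x t t', θ t x = θ t' x ↔ (t : AddCircle γ) = t' := by
  have hex : ∀ x, ∃ γ : ℝ, 0 < γ ∧ ∀ᶠ x' in 𝓝 x, ∀ t t', θ t x' = θ t' x' ↔
      (t : AddCircle γ) = t' := by
    intro x
    obtain ⟨U, γ, σ, hx, h⟩ := hbox (p x)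
    refine ⟨γ, h.pos, ?_⟩
    filter_upwards [hp.continuousAt.eventually (h.isOpen.mem_nhds hx)] with x' hx' t t'
    exact h.flow_eq_iff (hθ U γ σ h) hx' t t'
  choose per hpos hper using hex
  have hleast : ∀ {x : M} {γ : ℝ}, 0 < γ → (∀ t t', θ t x = θ t' x ↔ (t : AddCircle γ) = t') →
      IsLeast {T : ℝ | 0 < T ∧ θ T x = θ 0 x} γ := by
    intro x γ hγ h
    have := AddCircle.isLeast_pos_coe_eq_zero hγ
    simp only [h, AddCircle.coe_zero]
    exact this
  -- `per` is defined by choices, but its value is forced: it is the least positive return time. The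
  -- period valid near `x` must therefore agree with the one chosen at `x'`.
  have hloc : IsLocallyConstant per := by
    rw [IsLocallyConstant.iff_eventually_eq]
    intro x
    filter_upwards [hper x] with x' hx'
    exact (hleast (hpos x') (hper x').self_of_nhds).unique (hleast (hpos x) hx')
  obtain ⟨x₀⟩ := (inferInstance : Nonempty M)
  refine ⟨per x₀, hpos x₀, fun x => ?_⟩
  rw [← hloc.apply_eq_of_preconnectedSpace x x₀]
  exact (hper x).self_of_nhds

/-- The action of `ℝ/γℤ` induced by a flow all of whose orbits have period `γ`. -/
@[reducible]
def circleActionOfFlow {θ : ℝ → M → M} (h0 : ∀ x, θ 0 x = x)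
    (hadd : ∀ s t x, θ (s + t) x = θ s (θ t x))
    (hper : ∀ x t t', ((t : ℝ) : AddCircle γ) = (t' : ℝ) → θ t x = θ t' x) :
    AddAction (AddCircle γ) M where
  vadd q x := θ (Quotient.out q) x
  zero_vadd x := by
    refine (hper x _ 0 ?_).trans (h0 x)
    exact Quotient.out_eq (0 : AddCircle γ)
  add_vadd q q' x := by
    refine (hper x _ (Quotient.out q + Quotient.out q') ?_).trans (hadd _ _ _)
    rw [AddCircle.coe_add]
    exact (Quotient.out_eq (q + q')).trans
      (congrArg₂ (· + ·) (Quotient.out_eq q).symm (Quotient.out_eq q').symm)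

end GlobalFlow

/-! ### The principal bundle and its connection. -/

section CircleBundle

variable {E M EB B : Type*} [NormedAddCommGroup E] [NormedSpace ℝ E]
  [TopologicalSpace M] [ChartedSpace E M]
  [NormedAddCommGroup EB] [NormedSpace ℝ EB] [TopologicalSpace B] [ChartedSpace EB B]

/-- A free action of `ℝ/γℤ` which is the translation of the time in the flow boxes of `R`. -/
structure IsReebAction (p : M → B) (R : ∀ x : M, TangentSpace 𝓘(ℝ, E) x) (η : DForm E M 1)
    (γ : ℝ) [AddAction (AddCircle γ) M] : Prop where
  free : ∀ (g : AddCircle γ) (x : M), g +ᵥ x = x → g = 0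
  exists_box : ∀ b, ∃ (U : Set B) (δ : ℝ) (σ : B × ℝ → M), b ∈ U ∧
    IsFlowBox (EB := EB) p R η U δ σ ∧
      ∀ b ∈ U, ∀ t t' : ℝ, (t : AddCircle γ) +ᵥ σ (b, t') = σ (b, t' + t)

theorem AddCircle.contMDiff_coe (γ : ℝ) :
    ContMDiff 𝓘(ℝ, ℝ) 𝓘(ℝ, ℝ) ∞ (fun t : ℝ => (t : AddCircle γ)) := fun _ =>
  AddCircle.contMDiffAt_of_coe (AddCircle.continuous_mk' γ).continuousAt contMDiffAt_id
    (Eventually.of_forall fun _ => rfl)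

namespace IsReebAction

variable {p : M → B} {R : ∀ x : M, TangentSpace 𝓘(ℝ, E) x} {η : DForm E M 1} {γ : ℝ}
  [AddAction (AddCircle γ) M]

theorem vadd_left_injective (h : IsReebAction (EB := EB) p R η γ) {g g' : AddCircle γ} {x : M}
    (hg : g +ᵥ x = g' +ᵥ x) : g = g' := by
  have := h.free (-g' + g) x (by rw [add_vadd, hg, neg_vadd_vadd])
  exact (neg_add_eq_zero.1 this).symm

theorem proj_vadd (h : IsReebAction (EB := EB) p R η γ) (g : AddCircle γ) (x : M) :
    p (g +ᵥ x) = p x := by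
  obtain ⟨U, δ, σ, hx, hσ, hact⟩ := h.exists_box (p x)
  obtain ⟨t, ht⟩ := hσ.exists_eq hx
  obtain ⟨r, rfl⟩ := QuotientAddGroup.mk_surjective g
  conv_lhs => rw [← ht]
  exact (congrArg p (hact _ hx r t)).trans (hσ.proj (p x, t + r) hx)

/-- Locally the action is `(g, x) ↦ σ (p x, τ x + κ g)`, with `τ` the time in a box and `κ` a chart
of the circle. -/
theorem contMDiffVAdd (h : IsReebAction (EB := EB) p R η γ)
    (hp : ContMDiff 𝓘(ℝ, E) 𝓘(ℝ, EB) ∞ p) :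
    ContMDiffVAdd 𝓘(ℝ, ℝ) 𝓘(ℝ, E) ∞ (AddCircle γ) M where
  contMDiff_vadd := by
    rintro ⟨q₀, x₀⟩
    obtain ⟨U, δ, σ, hx, hσ, hact⟩ := h.exists_box (p x₀)
    obtain ⟨τ, hτ, hτσ⟩ := hσ.exists_time x₀ hx
    set κ := extChartAt 𝓘(ℝ, ℝ) q₀ with hκ
    have h1 : ContMDiffAt (𝓘(ℝ, ℝ).prod 𝓘(ℝ, E)) 𝓘(ℝ, EB) ∞
        (fun z : AddCircle γ × M => p z.2) (q₀, x₀) := hp.contMDiffAt.comp _ contMDiffAt_snd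
    have h2 : ContMDiffAt (𝓘(ℝ, ℝ).prod 𝓘(ℝ, E)) 𝓘(ℝ, ℝ) ∞
        (fun z : AddCircle γ × M => τ z.2 + κ z.1) (q₀, x₀) :=
      (ContMDiffAt.comp (g := τ) (q₀, x₀) hτ contMDiffAt_snd).add
        (ContMDiffAt.comp (g := κ) (q₀, x₀) contMDiffAt_extChartAt contMDiffAt_fst)
    have h3 := ContMDiffAt.comp (g := σ) (q₀, x₀) (hσ.contMDiffAt (p x₀, τ x₀ + κ q₀) hx)
      (h1.prodMk h2)
    refine h3.congr_of_eventuallyEq ?_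
    filter_upwards [continuousAt_fst.eventually (AddCircle.eventually_coe_extChartAt q₀),
      continuousAt_snd.eventually hτσ,
      (hp.continuous.comp continuous_snd).continuousAt.eventually (hσ.isOpen.mem_nhds hx)]
      with z hz1 hz2 hz3
    have := hact (p z.2) hz3 (κ z.1) (τ z.2)
    rw [hz2, hz1] at this
    exact this

/-- The equivariant trivialization defined by a flow box. -/
theorem exists_trivialization (h : IsReebAction (EB := EB) p R η γ)
    (hp : ContMDiff 𝓘(ℝ, E) 𝓘(ℝ, EB) ∞ p) (b : B) :
    ∃ e : Bundle.Trivialization (AddCircle γ) p, b ∈ e.baseSet ∧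
      IsSmoothTrivialization E EB ℝ e ∧
      ∀ x ∈ e.source, ∀ g : AddCircle γ, (e (g +ᵥ x)).2 = g + (e x).2 := by
  obtain ⟨U, δ, σ, hb, hσ, hact⟩ := h.exists_box b
  have hvadd := h.contMDiffVAdd hp
  -- The fiber coordinate `q x` is the group element carrying the section `σ (·, 0)` to `x`. It is
  -- unique by freeness, hence locally the class of the smooth time `τ`.
  have hex : ∀ x, ∃ q : AddCircle γ, p x ∈ U → q +ᵥ σ (p x, 0) = x := by
    intro x
    by_cases hx : p x ∈ U
    · obtain ⟨t, ht⟩ := hσ.exists_eq hx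
      refine ⟨(t : AddCircle γ), fun _ => ?_⟩
      rw [hact _ hx, zero_add, ht]
    · exact ⟨0, fun h => absurd h hx⟩
  choose q hq using hex
  have hsource : IsOpen (p ⁻¹' U) := hσ.isOpen.preimage hp.continuous
  have htarget : IsOpen (U ×ˢ (univ : Set (AddCircle γ))) := hσ.isOpen.prod isOpen_univ
  have hqs : ∀ x, p x ∈ U → ContMDiffAt 𝓘(ℝ, E) 𝓘(ℝ, ℝ) ∞ q x := by
    intro x hx
    obtain ⟨τ, hτ, hτσ⟩ := hσ.exists_time x hx
    refine ((AddCircle.contMDiff_coe γ).contMDiffAt.comp x hτ).congr_of_eventuallyEq ?_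
    filter_upwards [hτσ, hsource.mem_nhds hx] with x' h1 h2
    refine h.vadd_left_injective (x := σ (p x', 0)) ?_
    rw [hq x' h2]
    have := hact (p x') h2 (τ x') 0
    rw [zero_add, h1] at this
    exact this.symm
  have hinv : ∀ z : B × AddCircle γ, z.1 ∈ U → ContMDiffAt (𝓘(ℝ, EB).prod 𝓘(ℝ, ℝ)) 𝓘(ℝ, E) ∞
      (fun z : B × AddCircle γ => z.2 +ᵥ σ (z.1, 0)) z := by
    intro z hz
    have h1 : ContMDiffAt (𝓘(ℝ, EB).prod 𝓘(ℝ, ℝ)) 𝓘(ℝ, E) ∞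
        (fun z : B × AddCircle γ => σ (z.1, 0)) z :=
      ContMDiffAt.comp (g := σ) z (hσ.contMDiffAt (z.1, 0) hz)
        (contMDiffAt_fst.prodMk contMDiffAt_const)
    exact hvadd.contMDiff_vadd.contMDiffAt.comp z (contMDiffAt_snd.prodMk h1)
  have hproj : ∀ z : B × AddCircle γ, z.1 ∈ U → p (z.2 +ᵥ σ (z.1, 0)) = z.1 := fun z hz => by
    rw [h.proj_vadd, hσ.proj (z.1, 0) hz]
  have hfun : ∀ x, p x ∈ U → ContMDiffAt 𝓘(ℝ, E) (𝓘(ℝ, EB).prod 𝓘(ℝ, ℝ)) ∞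
      (fun x => (p x, q x)) x := fun x hx => hp.contMDiffAt.prodMk (hqs x hx)
  let e : Bundle.Trivialization (AddCircle γ) p :=
    { toFun := fun x => (p x, q x)
      invFun := fun z => z.2 +ᵥ σ (z.1, 0)
      source := p ⁻¹' U
      target := U ×ˢ univ
      map_source' := fun x hx => ⟨hx, mem_univ _⟩
      map_target' := fun z hz => by
        rw [mem_preimage, hproj z hz.1]; exact hz.1
      left_inv' := fun x hx => hq x hx
      right_inv' := fun z hz => by
        refine Prod.ext (hproj z hz.1) (h.vadd_left_injective (x := σ (z.1, 0)) ?_)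
        have h1 := hq (z.2 +ᵥ σ (z.1, 0)) (by rw [hproj z hz.1]; exact hz.1)
        rwa [hproj z hz.1] at h1
      open_source := hsource
      open_target := htarget
      continuousOn_toFun := fun x hx => (hfun x hx).continuousAt.continuousWithinAt
      continuousOn_invFun := fun z hz => (hinv z hz.1).continuousAt.continuousWithinAt
      baseSet := U
      open_baseSet := hσ.isOpen
      source_eq := rfl
      target_eq := rfl
      proj_toFun := fun _ _ => rfl }
  refine ⟨e, hb, ⟨fun x hx => (hfun x hx).contMDiffWithinAt,
    fun z hz => (hinv z hz.1).contMDiffWithinAt⟩, fun x hx g => ?_⟩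
  change q (g +ᵥ x) = g + q x
  have hx' : p x ∈ U := hx
  refine h.vadd_left_injective (x := σ (p x, 0)) ?_
  have h1 := hq (g +ᵥ x) (by rwa [h.proj_vadd])
  rw [h.proj_vadd] at h1
  rw [h1, add_vadd, hq x hx']

theorem isSmoothPrincipalBundle (h : IsReebAction (EB := EB) p R η γ)
    (hp : ContMDiff 𝓘(ℝ, E) 𝓘(ℝ, EB) ∞ p) :
    IsSmoothPrincipalBundle E EB ℝ (AddCircle γ) p where
  smooth_proj := hp
  smooth_action := h.contMDiffVAdd hp
  free := h.free
  fiber_iff x y := by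
    refine ⟨fun hxy => ?_, fun ⟨g, hg⟩ => by rw [← hg, h.proj_vadd]⟩
    obtain ⟨U, δ, σ, hx, hσ, hact⟩ := h.exists_box (p x)
    obtain ⟨t, ht⟩ := hσ.exists_eq hx
    obtain ⟨t', ht'⟩ := hσ.exists_eq (x := y) (hxy ▸ hx)
    refine ⟨((t' - t : ℝ) : AddCircle γ), ?_⟩
    have := hact _ hx (t' - t) t
    rw [ht] at this
    rw [this, add_sub_cancel, hxy, ht']
  locally_trivial := h.exists_trivialization hp

theorem mfderiv_orbit (h : IsReebAction (EB := EB) p R η γ) (x : M) :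
    HasMFDerivAt 𝓘(ℝ, ℝ) 𝓘(ℝ, E) (fun t : ℝ => (t : AddCircle γ) +ᵥ x) 0
      ((1 : ℝ →L[ℝ] ℝ).smulRight (R x : E)) := by
  obtain ⟨U, δ, σ, hx, hσ, hact⟩ := h.exists_box (p x)
  obtain ⟨t, ht⟩ := hσ.exists_eq hx
  have h1 := (hσ.curve _ hx).comp_add t
  have h2 : (fun r : ℝ => (r : AddCircle γ) +ᵥ x) = (fun s => σ (p x, s)) ∘ fun s => s + t := by
    funext r
    have := hact _ hx r t
    rw [ht] at this
    rw [this, add_comm]; rfl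
  rw [h2]
  have h3 := h1 0
  have h4 : ((fun s => σ (p x, s)) ∘ fun s => s + t) 0 = x := by simpa using ht
  have key : ∀ x', x' = x → ((1 : ℝ →L[ℝ] ℝ).smulRight (R x' : E)) =
      ((1 : ℝ →L[ℝ] ℝ).smulRight (R x : E)) := by rintro _ rfl; rfl
  exact h3.congr_mfderiv (key _ h4)

theorem fundamentalField_eq (h : IsReebAction (EB := EB) p R η γ) (x : M) :
    fundamentalField γ x = R x := by
  have := congrArg (fun L : ℝ →L[ℝ] E => L 1) (h.mfderiv_orbit x).mfderiv
  exact Eq.trans this (one_smul ℝ (R x : E))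

/-- In a box the action translates `t`, which changes neither `dt` nor `A`. -/
theorem pullback_vadd (h : IsReebAction (EB := EB) p R η γ)
    (hp : ContMDiff 𝓘(ℝ, E) 𝓘(ℝ, EB) ∞ p) (g : AddCircle γ) :
    η.pullback (fun x : M => g +ᵥ x) = η := by
  funext x
  obtain ⟨U, δ, σ, hx, hσ, hact⟩ := h.exists_box (p x)
  obtain ⟨τ, hτ, hτσ⟩ := hσ.exists_time x hx
  obtain ⟨r, rfl⟩ := QuotientAddGroup.mk_surjective g
  obtain ⟨A, hA⟩ := hσ.form _ hx
  have hpd := (hp.mdifferentiableAt (x := x) (by simp)).hasMFDerivAt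
  have hτd := (hτ.mdifferentiableAt (by simp)).hasMFDerivAt
  set Lτ : E →L[ℝ] ℝ := mfderiv 𝓘(ℝ, E) 𝓘(ℝ, ℝ) τ x
  set Lp : E →L[ℝ] EB := mfderiv 𝓘(ℝ, E) 𝓘(ℝ, EB) p x
  have hev : ∀ᶠ x' in 𝓝 x, p x' ∈ U :=
    hp.continuous.continuousAt.eventually (hσ.isOpen.mem_nhds hx)
  -- The right side does not involve `r`, so an arbitrary `r` can be compared with `r = 0`, where
  -- the action is the identity.
  have htrans : ∀ r : ℝ, ∀ v : E, η ((r : AddCircle γ) +ᵥ x)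
      ![(mfderiv 𝓘(ℝ, E) 𝓘(ℝ, E) (fun x : M => (r : AddCircle γ) +ᵥ x) x v : E)] =
        Lτ v + A (Lp v) := by
    intro r v
    have h1 : HasMFDerivAt 𝓘(ℝ, E) 𝓘(ℝ, ℝ) (fun x => τ x + r) x Lτ := by
      have h0 : HasMFDerivAt 𝓘(ℝ, ℝ) 𝓘(ℝ, ℝ) (fun t : ℝ => t + r) (τ x)
        (ContinuousLinearMap.id ℝ ℝ) := ((hasFDerivAt_id (τ x)).add_const r).hasMFDerivAt
      exact HasMFDerivAt.comp x h0 hτd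
    have h2 := HasMFDerivAt.prodMk hpd h1
    have h3 := ((hσ.contMDiffAt (p x, τ x + r) hx).mdifferentiableAt (by simp)).hasMFDerivAt
    have h4 := HasMFDerivAt.comp x h3 h2
    have h5 : (fun x : M => (r : AddCircle γ) +ᵥ x) =ᶠ[𝓝 x] σ ∘ fun x => (p x, τ x + r) := by
      filter_upwards [hτσ, hev] with x' h1 h2
      have := hact _ h2 r (τ x')
      rw [h1] at this
      exact this
    have h6 := (h4.congr_of_eventuallyEq h5).mfderiv
    have h7 := congrArg (fun L : E →L[ℝ] E => L v) h6
    have key : ∀ x x' : M, x = x' → ∀ v v' : E, v = v' → (η x ![v] : ℝ) = η x' ![v'] := by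
      rintro x _ rfl v _ rfl; rfl
    exact (key _ _ h5.self_of_nhds _ _ h7).trans (hA (τ x + r) (Lp v, Lτ v))
  have hone : ∀ (y : M) (v : Fin 1 → E), (η y v : ℝ) = η y ![v 0] := by
    intro y v; congr 1; ext i; fin_cases i; rfl
  ext v
  have e1 := htrans r (v 0)
  have e2 := htrans 0 (v 0)
  have hid : (fun x : M => ((0 : ℝ) : AddCircle γ) +ᵥ x) = id := by
    funext x; simp
  have key : ∀ f : M → M, f = id → (η (f x) ![(mfderiv 𝓘(ℝ, E) 𝓘(ℝ, E) f x (v 0) : E)] : ℝ) =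
      η x ![(v 0 : E)] := by
    rintro _ rfl
    rw [mfderiv_id]; rfl
  rw [key _ hid] at e2
  exact (hone _ _).trans ((e1.trans e2.symm).trans (hone _ _).symm)

theorem isConnectionForm (h : IsReebAction (EB := EB) p R η γ)
    (hR : IsReebPair (EB := EB) p R η) : IsConnectionForm γ η where
  smooth := hR.smooth_form
  apply_fundamentalField x := by rw [h.fundamentalField_eq, hR.apply_field]
  invariant := h.pullback_vadd hR.contMDiff_proj

/-- The horizontal projection changes vectors only by multiples of `R`, which `dη` annihilates. -/
theorem connectionCurvature_eq (h : IsReebAction (EB := EB) p R η γ)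
    (hR : IsReebPair (EB := EB) p R η) : connectionCurvature γ η = η.d := by
  funext x
  ext v
  have h1 : ∀ w : Fin 2 → E, (η.d x w : ℝ) = η.d x ![w 0, w 1] := by
    intro w; congr 1; ext i; fin_cases i <;> rfl
  have h2 : ∀ w : TangentSpace 𝓘(ℝ, E) x, ∃ a : ℝ, horizontalProj γ η x w = w - a • R x :=
    fun w => ⟨_, by rw [← h.fundamentalField_eq]; rfl⟩
  obtain ⟨a, ha⟩ := h2 (v 0)
  obtain ⟨b, hb⟩ := h2 (v 1)
  have h3 : ∀ (c : ℝ) (u w : TangentSpace 𝓘(ℝ, E) x),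
      η.d x ![u - c • R x, w] = η.d x ![u, w] := by
    intro c u w
    rw [ContinuousAlternatingMap.map_sub_left, ContinuousAlternatingMap.map_smul_left,
      hR.contraction, mul_zero, sub_zero]
  have h4 : connectionCurvature γ η x v =
      η.d x ![horizontalProj γ η x (v 0), horizontalProj γ η x (v 1)] := h1 _
  rw [h4, ha, hb, h3, ContinuousAlternatingMap.map_swap_two, h3,
    ← ContinuousAlternatingMap.map_swap_two]
  exact (h1 v).symm

end IsReebAction

end CircleBundle

/-! ### Descent of `dη` to the base. -/

section BaseForm

variable {E M EB B : Type*} [NormedAddCommGroup E] [NormedSpace ℝ E]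
  [TopologicalSpace M] [ChartedSpace E M]
  [NormedAddCommGroup EB] [NormedSpace ℝ EB] [TopologicalSpace B] [ChartedSpace EB B]
  {p : M → B} {R : ∀ x : M, TangentSpace 𝓘(ℝ, E) x} {η : DForm E M 1}

/-- The points of angle `0` form a section. Pulling back along such sections transfers statements
about forms from `M` to the base. -/
theorem IsPolarChart.exists_section [IsManifold 𝓘(ℝ, EB) ∞ B] {b₀ : B} {W : Set EB}
    {F : EB × ℝ → M} (hF : IsPolarChart (E := E) p b₀ W F) :
    ∃ s : B → M, ∀ᶠ b in 𝓝 b₀, ContMDiffAt 𝓘(ℝ, EB) 𝓘(ℝ, E) ∞ s b ∧ p (s b) = b := by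
  set φ := extChartAt 𝓘(ℝ, EB) b₀
  have hUo : IsOpen (φ.source ∩ φ ⁻¹' W) :=
    (continuousOn_extChartAt b₀).isOpen_inter_preimage (isOpen_extChartAt_source b₀) hF.isOpen
  refine ⟨fun b => F (φ b, 0), ?_⟩
  filter_upwards [hUo.mem_nhds ⟨mem_extChartAt_source b₀, hF.mem⟩] with b hb
  have hφ : ContMDiffAt 𝓘(ℝ, EB) 𝓘(ℝ, EB) ∞ φ b :=
    contMDiffAt_extChartAt' (by rw [← extChartAt_source 𝓘(ℝ, EB)]; exact hb.1)
  refine ⟨ContMDiffAt.comp (g := F) b (hF.contMDiffAt (φ b, 0) hb.2)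
    (hφ.prodMk_space contMDiffAt_const), ?_⟩
  rw [hF.proj (φ b, 0) hb.2]
  exact φ.left_inv hb.1

theorem DForm.apply_congr_point {k : ℕ} (Ω : DForm EB B k) {b b' : B} (hb : b = b')
    {v v' : Fin k → EB} (hv : v = v') : (Ω b v : ℝ) = Ω b' v' := by
  subst hb hv; rfl

/-- Pulling back along a map with local sections is injective on forms. -/
theorem DForm.pullback_injective_of_section (hp : ContMDiff 𝓘(ℝ, E) 𝓘(ℝ, EB) ∞ p)
    (hsec : ∀ b₀ : B, ∃ s : B → M,
      ∀ᶠ b in 𝓝 b₀, ContMDiffAt 𝓘(ℝ, EB) 𝓘(ℝ, E) ∞ s b ∧ p (s b) = b)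
    {k : ℕ} {Ω Ω' : DForm EB B k} (h : Ω.pullback (E' := E) p = Ω'.pullback p) : Ω = Ω' := by
  funext b
  ext v
  obtain ⟨s, hs⟩ := hsec b
  have hsb := hs.self_of_nhds
  have hsd := (hsb.1.mdifferentiableAt (by simp)).hasMFDerivAt
  have h1 := HasMFDerivAt.comp b (hp.mdifferentiableAt (x := s b) (by simp)).hasMFDerivAt hsd
  have h2 : HasMFDerivAt 𝓘(ℝ, EB) 𝓘(ℝ, EB) (p ∘ s) b (ContinuousLinearMap.id ℝ EB) :=
    (hasMFDerivAt_id b).congr_of_eventuallyEq (hs.mono fun b hb => hb.2)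
  have h3 := hasMFDerivAt_unique h1 h2
  have h4 : (fun i => (mfderiv 𝓘(ℝ, E) 𝓘(ℝ, EB) p (s b)
      (mfderiv 𝓘(ℝ, EB) 𝓘(ℝ, E) s b (v i)) : EB)) = v :=
    funext fun i => congrArg (fun L : EB →L[ℝ] EB => L (v i)) h3
  have h5 := congrArg (fun α : DForm E M k =>
    α (s b) fun i => mfderiv 𝓘(ℝ, EB) 𝓘(ℝ, E) s b (v i)) h
  exact (Ω.apply_congr_point hsb.2 h4).symm.trans (Eq.trans h5 (Ω'.apply_congr_point hsb.2 h4))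

/-- Coordinate expressions of a form whose pullback is exact. -/
theorem DForm.inChart_eventuallyEq_extDeriv [IsManifold 𝓘(ℝ, E) ∞ M] [IsManifold 𝓘(ℝ, EB) ∞ B]
    (hp : ContMDiff 𝓘(ℝ, E) 𝓘(ℝ, EB) ∞ p)
    (hsec : ∀ b₀ : B, ∃ s : B → M,
      ∀ᶠ b in 𝓝 b₀, ContMDiffAt 𝓘(ℝ, EB) 𝓘(ℝ, E) ∞ s b ∧ p (s b) = b)
    {k : ℕ} {α : DForm E M k} (hα : α.IsSmooth) {Ω : DForm EB B (k + 1)} (h : α.d = Ω.pullback p)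
    (b₁ : B) {y : EB} (hy : y ∈ (extChartAt 𝓘(ℝ, EB) b₁).target) :
    ∃ σ : EB → M, ContMDiffAt 𝓘(ℝ, EB) 𝓘(ℝ, E) ∞ σ y ∧
      Ω.inChart b₁ =ᶠ[𝓝 y] extDeriv (α.pullbackVec σ) := by
  set ψ := (extChartAt 𝓘(ℝ, EB) b₁).symm with hψ
  have hψs : ∀ᶠ y' in 𝓝 y, ContMDiffAt 𝓘(ℝ, EB) 𝓘(ℝ, EB) ∞ ψ y' := by
    filter_upwards [(isOpen_extChartAt_target b₁).mem_nhds hy] with y' hy'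
    exact (contMDiffOn_extChartAt_symm b₁).contMDiffAt ((isOpen_extChartAt_target b₁).mem_nhds hy')
  obtain ⟨s, hs⟩ := hsec (ψ y)
  have hs' := hψs.self_of_nhds.continuousAt.eventually hs
  have hσ : ∀ᶠ y' in 𝓝 y, ContMDiffAt 𝓘(ℝ, EB) 𝓘(ℝ, E) ∞ (fun y => s (ψ y)) y' := by
    filter_upwards [hψs, hs'] with y' h1 h2
    exact h2.1.comp y' h1
  refine ⟨fun y => s (ψ y), hσ.self_of_nhds, ?_⟩
  filter_upwards [hσ, hs'.eventually_nhds] with y' h1 h2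
  -- Since `p ∘ s ∘ ψ = ψ` near `y'`, the pullback of `p^*Ω` along `s ∘ ψ` is `ψ^*Ω`, the chart
  -- expression of `Ω`.
  rw [DForm.extDeriv_pullbackVec hα h1, h]
  ext v
  have h3 := HasMFDerivAt.comp y' (hp.mdifferentiableAt (x := s (ψ y')) (by simp)).hasMFDerivAt
    (h1.mdifferentiableAt (by simp)).hasMFDerivAt
  have h4 := (h3.congr_of_eventuallyEq (h2.mono fun z hz => hz.2.symm)).mfderiv
  refine Ω.apply_congr_point h2.self_of_nhds.2.symm (funext fun i => ?_)
  exact congrArg (fun L : EB →L[ℝ] EB => L (v i)) h4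

/-- The form `dη` descends to a unique 2-form on the base, which is smooth and closed. -/
theorem IsReebPair.exists_base_form [IsManifold 𝓘(ℝ, E) ∞ M] [IsManifold 𝓘(ℝ, EB) ∞ B]
    (hR : IsReebPair (EB := EB) p R η)
    (hpolar : ∀ b, ∃ (W : Set EB) (F : EB × ℝ → M), IsPolarChart (E := E) p b W F) :
    ∃ Ω : DForm EB B 2, Ω.IsSmooth ∧ Ω.d = 0 ∧ η.d = Ω.pullback p ∧
      ∀ Ω' : DForm EB B 2, η.d = Ω'.pullback p → Ω' = Ω := by
  have hex : ∀ b : B, ∃ μ : TangentSpace 𝓘(ℝ, EB) b [⋀^Fin 2]→L[ℝ] ℝ, ∀ x, p x = b →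
      ∀ v : Fin 2 → TangentSpace 𝓘(ℝ, E) x, η.d x v =
        μ fun i => (mfderiv 𝓘(ℝ, E) 𝓘(ℝ, EB) p x (v i) : EB) := by
    intro b
    obtain ⟨W, F, hF⟩ := hpolar b
    exact hF.exists_d_eq_comp hR
  have hsec : ∀ b₀ : B, ∃ s : B → M,
      ∀ᶠ b in 𝓝 b₀, ContMDiffAt 𝓘(ℝ, EB) 𝓘(ℝ, E) ∞ s b ∧ p (s b) = b := by
    intro b
    obtain ⟨W, F, hF⟩ := hpolar b
    exact hF.exists_section
  choose Ω hΩ using hex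
  have hpull : η.d = DForm.pullback p (Ω : DForm EB B 2) := by
    funext x
    ext v
    exact hΩ (p x) x rfl v
  refine ⟨Ω, DForm.isSmooth_iff_contDiffAt.2 fun b y hy => ?_, ?_, hpull, fun Ω' hΩ' =>
    DForm.pullback_injective_of_section hR.contMDiff_proj hsec (hΩ'.symm.trans hpull)⟩
  · obtain ⟨σ, hσ, hev⟩ := DForm.inChart_eventuallyEq_extDeriv hR.contMDiff_proj hsec
      hR.smooth_form hpull b hy
    exact (contDiffAt_extDeriv
      (DForm.contDiffAt_pullbackVec_one hR.smooth_form hσ)).congr_of_eventuallyEq hev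
  · funext b
    obtain ⟨σ, hσ, hev⟩ := DForm.inChart_eventuallyEq_extDeriv hR.contMDiff_proj hsec
      hR.smooth_form hpull b (mem_extChartAt_target b)
    -- Closedness is `d ∘ d = 0`, because the chart expression of the form is locally exact.
    have h0 : extDeriv (DForm.inChart (Ω : DForm EB B 2) b) (extChartAt 𝓘(ℝ, EB) b b) = 0 := by
      rw [hev.extDeriv_eq]
      exact extDeriv_extDeriv_apply (DForm.contDiffAt_pullbackVec_one hR.smooth_form hσ)
        minSmoothness_two_le_infty
    ext v
    exact congrArg (fun μ : EB [⋀^Fin 3]→L[ℝ] ℝ => μ fun i =>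
      (mfderiv 𝓘(ℝ, EB) 𝓘(ℝ, EB) (extChartAt 𝓘(ℝ, EB) b) b (v i) : EB)) h0

end BaseForm

/-! ### The Reeb data of a generalized almost contact structure, and the theorem. -/

section Main

variable {E M : Type*} [NormedAddCommGroup E] [NormedSpace ℝ E] [TopologicalSpace M]
  [ChartedSpace E M]

/-- Vector fields are tangent to the fibers of the projection onto their leaf space. -/
theorem mfderiv_leafProj_apply [CompleteSpace E] [IsManifold 𝓘(ℝ, E) 1 M]
    {R : ∀ x : M, TangentSpace 𝓘(ℝ, E) x}
    {EB : Type*} [NormedAddCommGroup EB] [NormedSpace ℝ EB] [ChartedSpace EB (LeafSpace R)]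
    (hR : ContMDiff 𝓘(ℝ, E) 𝓘(ℝ, E).tangent 1 (fun x => (⟨x, R x⟩ : TangentBundle 𝓘(ℝ, E) M)))
    (hp : ContMDiff 𝓘(ℝ, E) 𝓘(ℝ, EB) ∞ (leafProj R)) (x : M) :
    mfderiv 𝓘(ℝ, E) 𝓘(ℝ, EB) (leafProj R) x (R x) = 0 := by
  obtain ⟨c, hc0, hc⟩ := exists_isMIntegralCurveAt_of_contMDiffAt_boundaryless (t₀ := 0)
    (hR.contMDiffAt (x := x))
  subst hc0
  obtain ⟨ε, hε, hball⟩ := isMIntegralCurveAt_iff'.1 hc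
  rw [Real.ball_eq_Ioo] at hball
  have hmem : Ioo (0 - ε) (0 + ε) ∈ 𝓝 (0 : ℝ) := Ioo_mem_nhds (by linarith) (by linarith)
  -- All points of an integral curve lie on one orbit, so the projection is constant along it and
  -- its derivative kills the velocity `R`.
  have hconst : (leafProj R ∘ c) =ᶠ[𝓝 0] fun _ => leafProj R (c 0) := by
    filter_upwards [hmem] with t ht
    exact Quot.sound ⟨c, _, _, hball, t, ht, 0, mem_of_mem_nhds hmem, rfl, rfl⟩
  have h1 := HasMFDerivAt.comp 0 (hp.mdifferentiableAt (x := c 0) (by simp)).hasMFDerivAt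
    hc.self_of_nhds
  have h2 : HasMFDerivAt 𝓘(ℝ, ℝ) 𝓘(ℝ, EB) (leafProj R ∘ c) 0 (0 : ℝ →L[ℝ] EB) :=
    (hasMFDerivAt_const (leafProj R (c 0)) (0 : ℝ)).congr_of_eventuallyEq hconst
  have h3 := congrArg (fun L : ℝ →L[ℝ] EB => L 1) (hasMFDerivAt_unique h1 h2)
  have h4 : mfderiv 𝓘(ℝ, E) 𝓘(ℝ, EB) (leafProj R) (c 0) ((1 : ℝ) • R (c 0)) = (0 : EB) := h3
  rwa [one_smul] at h4

namespace GenAlmostContactStructure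

variable [IsManifold 𝓘(ℝ, E) ∞ M] (S : GenAlmostContactStructure E M)

theorem contMDiff_R :
    ContMDiff 𝓘(ℝ, E) 𝓘(ℝ, E).tangent ∞ (fun x => (⟨x, S.R x⟩ : TangentBundle 𝓘(ℝ, E) M)) :=
  ContMDiff.add_section S.smooth_Ep.1 S.smooth_Em.1

theorem isSmooth_η : S.η.IsSmooth := S.smooth_Ep.2.ofCovectors_add S.smooth_Em.2

/-- `η(R)` is the pairing of `E₊ + E₋` with itself, that is `0 + 2 · (1/2) + 0`. -/
theorem η_apply_R (x : M) : S.η x ![S.R x] = 1 := by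
  have h1 := S.pairing_Ep_Em x
  have h2 := S.pairing_Ep_Ep x
  have h3 := S.pairing_Em_Em x
  simp only [genPairing] at h1 h2 h3
  have h4 : S.η x ![S.R x] = ((S.Ep x).2 + (S.Em x).2) ((S.Ep x).1 + (S.Em x).1) := rfl
  rw [h4, add_apply, map_add, map_add]
  linarith

end GenAlmostContactStructure

end Main

end

theorem theorem3p1 (n : ℕ) {M : Type*} [TopologicalSpace M]
    [ChartedSpace (EuclideanSpace ℝ (Fin (2 * n + 1))) M] [IsManifold (𝓡 (2 * n + 1)) ∞ M]
    [T2Space M] [SecondCountableTopology M] [ConnectedSpace M]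
    (S : GenAlmostContactStructure (EuclideanSpace ℝ (Fin (2 * n + 1))) M)
    [ChartedSpace (EuclideanSpace ℝ (Fin (2 * n))) (LeafSpace S.R)]
    [IsManifold (𝓡 (2 * n)) ∞ (LeafSpace S.R)] [T2Space (LeafSpace S.R)]
    (hreg : Manifold.IsSubmersion (𝓡 (2 * n + 1)) (𝓡 (2 * n)) ∞ (leafProj S.R))
    (hη : ∀ (x : M) (v : TangentSpace (𝓡 (2 * n + 1)) x), S.η.d x ![S.R x, v] = 0)
    (hbundle : IsSmoothFiberBundle (EuclideanSpace ℝ (Fin (2 * n + 1))) (EuclideanSpace ℝ (Fin (2 * n)))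
      (EuclideanSpace ℝ (Fin 1)) Circle (leafProj S.R)) :
    ∃ θ : ℝ → M → M, IsGlobalFlow S.R θ ∧
      ∃ γ : ℝ, 0 < γ ∧
        (∀ x : M, IsLeast {T : ℝ | 0 < T ∧ Function.Periodic (fun t => θ t x) T} γ) ∧
        ∃ _ : AddAction (AddCircle γ) M,
          (∀ (t : ℝ) (x : M), (t : AddCircle γ) +ᵥ x = θ t x) ∧
          IsSmoothPrincipalBundle (EuclideanSpace ℝ (Fin (2 * n + 1)))
            (EuclideanSpace ℝ (Fin (2 * n))) ℝ (AddCircle γ) (leafProj S.R) ∧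
          IsConnectionForm γ S.η ∧
          ∃ Ω : DForm (EuclideanSpace ℝ (Fin (2 * n))) (LeafSpace S.R) 2,
            Ω.IsSmooth ∧ Ω.d = 0 ∧
            connectionCurvature γ S.η = Ω.pullback (leafProj S.R) ∧
            S.η.d = Ω.pullback (leafProj S.R) ∧
            ∀ Ω' : DForm (EuclideanSpace ℝ (Fin (2 * n))) (LeafSpace S.R) 2,
              S.η.d = Ω'.pullback (leafProj S.R) → Ω' = Ω := by
  have hp := hbundle.contMDiff
  have hR1 := S.contMDiff_R.of_le (m := 1) (by simp)
  have hReeb : IsReebPair (leafProj S.R) S.R S.η :=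
    ⟨hp, S.isSmooth_η, S.η_apply_R, hη, mfderiv_leafProj_apply hR1 hp⟩
  have hpolar := hbundle.exists_isPolarChart
  have hbox : ∀ b, ∃ (U : Set (LeafSpace S.R)) (γ : ℝ) (σ : LeafSpace S.R × ℝ → M), b ∈ U ∧
      IsFlowBox (EB := EuclideanSpace ℝ (Fin (2 * n))) (leafProj S.R) S.R S.η U γ σ := by
    intro b
    obtain ⟨W, F, hF⟩ := hpolar b
    exact hF.exists_isFlowBox hReeb
  obtain ⟨θ, hθ, hadd, hθbox⟩ := exists_isGlobalFlow hR1 hbox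
  obtain ⟨γ, hγ, hper⟩ := exists_common_period hp.continuous hbox hθbox
  have hθ0 : ∀ x, θ 0 x = x := fun x => (hθ x).1
  refine ⟨θ, hθ, γ, hγ, fun x => ?_, circleActionOfFlow (γ := γ) hθ0 hadd
    fun x t t' h => (hper x t t').2 h, ?_⟩
  -- `θ (t + T) x = θ t x` means that `t + T` and `t` agree in `ℝ/γℤ`, a condition on `T` alone.
  · have : {T : ℝ | 0 < T ∧ Function.Periodic (fun t => θ t x) T} =
        {T : ℝ | 0 < T ∧ (T : AddCircle γ) = 0} := by
      ext T
      simp only [Function.Periodic, hper, AddCircle.coe_add, add_eq_left, forall_const]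
    rw [this]
    exact AddCircle.isLeast_pos_coe_eq_zero hγ
  · let : AddAction (AddCircle γ) M := circleActionOfFlow (γ := γ) hθ0 hadd
      fun x t t' h => (hper x t t').2 h
    have hact : ∀ (t : ℝ) (x : M), (t : AddCircle γ) +ᵥ x = θ t x := fun t x =>
      (hper x _ t).2 (Quotient.out_eq (t : AddCircle γ))
    have hRA : IsReebAction (EB := EuclideanSpace ℝ (Fin (2 * n))) (leafProj S.R) S.R S.η γ := by
      refine ⟨fun g x hg => ?_, fun b => ?_⟩
      · obtain ⟨r, rfl⟩ := QuotientAddGroup.mk_surjective g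
        have h1 : θ r x = θ 0 x := (hact r x).symm.trans (hg.trans (hθ0 x).symm)
        exact (hper x r 0).1 h1
      · obtain ⟨U, δ, σ, hb, hσ⟩ := hbox b
        exact ⟨U, δ, σ, hb, hσ, fun b hb t t' => (hact t _).trans (hθbox U δ σ hσ b hb t t')⟩
    obtain ⟨Ω, hΩs, hΩd, hΩ, huniq⟩ := hReeb.exists_base_form hpolar
    exact ⟨hact, hRA.isSmoothPrincipalBundle hp, hRA.isConnectionForm hReeb, Ω, hΩs, hΩd,
      (hRA.connectionCurvature_eq hReeb).trans hΩ, hΩ, huniq⟩
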